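/- Let $M\ge 2$ and $N\ge 0$ be integers and let $D$ be the alphabet of $2M+N$ symbols consisting of left brackets $\alpha_1,\dots,\alpha_M$, right brackets $\beta_1,\dots,\beta_M$ and units $1_1,\dots,1_N$. Consider the monoid with zero (with zero element $0$ and unit element $1$) generated by $D$ subject to the relations $\alpha_i\beta_i=1$ for all $i$, $\alpha_i\beta_j=0$ for $i\ne j$, and $1_\ell=1$ for all $\ell$. The $(M,N)$ Dyck–Motzkin shift $\Sigma_D$ is the set of all $x=(x_i)_{i\in\mathbb Z}\in D^{\mathbb Z}$ such that for all integers $j<k$ the product $x_jx_{j+1}\cdots x_k$ is non-zero in this monoid. It carries the topology induced by the product topology on $D^{\mathbb Z}$ ($D$ discrete) and the left shift $(\sigma x)_i=x_{i+1}$. Then the space of $\sigma$-invariant ergodic Borel probability measures on $\Sigma_D$, endowed with the weak* topology, is path connected and locally path connected. -/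

import Mathlib

open MeasureTheory

namespace DyckMotzkin

/-- The alphabet `D = D_α ∪ D_0 ∪ D_β` of the `(M, N)` Dyck-Motzkin shift: `M` left brackets
`α_i`, `N` units `1_ℓ` and `M` right brackets `β_i`, where `α_i` and `β_i` are in pair. -/
inductive Letter (M N : ℕ) : Type
  | left (i : Fin M) : Letter M N
  | unit (l : Fin N) : Letter M N
  | right (i : Fin M) : Letter M N

instance (M N : ℕ) : Finite (Letter M N) :=
  Finite.of_surjective
    (fun s : Fin M ⊕ Fin N ⊕ Fin M => match s with
      | Sum.inl i => Letter.left i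
      | Sum.inr (Sum.inl l) => Letter.unit l
      | Sum.inr (Sum.inr i) => Letter.right i)
    (by
      rintro (i | l | i)
      · exact ⟨Sum.inl i, rfl⟩
      · exact ⟨Sum.inr (Sum.inl l), rfl⟩
      · exact ⟨Sum.inr (Sum.inr i), rfl⟩)

/-- The alphabet is a discrete space. -/
instance (M N : ℕ) : TopologicalSpace (Letter M N) := ⊥

instance (M N : ℕ) : DiscreteTopology (Letter M N) := ⟨rfl⟩

instance (M N : ℕ) : MeasurableSpace (Letter M N) := borel _

instance (M N : ℕ) : BorelSpace (Letter M N) := ⟨rfl⟩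

/-- A symbol as an element of the free monoid with zero on the alphabet. -/
def gen {M N : ℕ} (s : Letter M N) : WithZero (FreeMonoid (Letter M N)) :=
  ((FreeMonoid.of s : FreeMonoid (Letter M N)) : WithZero (FreeMonoid (Letter M N)))

/-- The defining relations: `α_i β_j = δ_{i,j}`, and every `1_ℓ` acts as the unit element `1`.
(The relations saying that `0` is absorbing and `1` is neutral already hold in the free monoid
with zero.) -/
inductive Rel (M N : ℕ) :
    WithZero (FreeMonoid (Letter M N)) → WithZero (FreeMonoid (Letter M N)) → Prop
  | match_eq (i : Fin M) : Rel M N (gen (Letter.left i) * gen (Letter.right i)) 1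
  | mismatch (i j : Fin M) (h : i ≠ j) : Rel M N (gen (Letter.left i) * gen (Letter.right j)) 0
  | unit_eq (l : Fin N) : Rel M N (gen (Letter.unit l)) 1

/-- The congruence on the free monoid with zero generated by the defining relations. -/
def bracketCon (M N : ℕ) : Con (WithZero (FreeMonoid (Letter M N))) := conGen (Rel M N)

/-- The monoid with zero generated by the alphabet subject to the defining relations. -/
abbrev BracketMonoid (M N : ℕ) : Type := (bracketCon M N).Quotient

/-- The zero element of `BracketMonoid M N` is the class of zero. -/
instance (M N : ℕ) : Zero (BracketMonoid M N) := ⟨(bracketCon M N).mk' 0⟩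

/-- `red (ω_1 ⋯ ω_n)` is the product of the letters `ω_1, …, ω_n` in `BracketMonoid M N`. -/
def red {M N : ℕ} (w : List (Letter M N)) : BracketMonoid M N :=
  (w.map fun s => (bracketCon M N).mk' (gen s)).prod

/-- The block `x_j x_{j+1} ⋯ x_k` of a bi-infinite sequence (for `j ≤ k`). -/
def block {S : Type*} (x : ℤ → S) (j k : ℤ) : List S :=
  (List.range (k + 1 - j).toNat).map fun i : ℕ => x (j + i)

/-- The `(M, N)` Dyck-Motzkin shift. -/
def dyckMotzkinShift (M N : ℕ) : Set (ℤ → Letter M N) :=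
  {x | ∀ j k : ℤ, j < k → red (block x j k) ≠ 0}

/-- The left shift `(σ x)_i = x_{i+1}` on bi-infinite sequences. -/
def leftShift {S : Type*} (x : ℤ → S) : ℤ → S := fun i => x (i + 1)

theorem mapsTo_leftShift (M N : ℕ) :
    Set.MapsTo leftShift (dyckMotzkinShift M N) (dyckMotzkinShift M N) := by
  intro x hx j k hjk
  have h : block (leftShift x) j k = block x (j + 1) (k + 1) := by
    have e : (k + 1 + 1 - (j + 1)).toNat = (k + 1 - j).toNat := by congr 1; ring
    unfold block leftShift
    rw [e]
    refine List.map_congr_left fun i _ => ?_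
    congr 1
    ring
  rw [h]
  exact hx _ _ (by linarith)

/-- The left shift acting on the Dyck-Motzkin shift. -/
def shift (M N : ℕ) : dyckMotzkinShift M N → dyckMotzkinShift M N :=
  (mapsTo_leftShift M N).restrict leftShift (dyckMotzkinShift M N) (dyckMotzkinShift M N)

/-- The shift-invariant ergodic Borel probability measures on the Dyck-Motzkin shift, as a subset
of the space of all Borel probability measures with the weak* topology (in Mathlib, `Ergodic`
includes invariance of the measure). -/
def ergodicMeasures (M N : ℕ) : Set (ProbabilityMeasure (dyckMotzkinShift M N)) :=
  {μ | Ergodic (shift M N) (μ : Measure (dyckMotzkinShift M N))}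

end DyckMotzkin

/-! Let the height of a sequence go up by 1 at a left bracket and down by 1 at a right one. A
sequence lies in the shift exactly when brackets that are partners by height carry equal indices
(`WellMatched.of_mem`, `WellMatched.mem`). So giving every matched right bracket the index of its
partner is an equivariant retraction `rematch` of the full shift, and ergodic measures may be built
on the full shift and pushed forward. The retraction can be discontinuous only where some right
bracket is unmatched, and an ergodic measure of nonnegative drift (mean height increment) does not
charge such sequences (`ae_rightMatched`).

To join two ergodic measures μ, ν of nonnegative drift, cut time at independent renewals of rate p
and fill each block with a fresh sample, of ν with probability s and of μ otherwise. The result is a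
factor of a Bernoulli shift, hence ergodic, and on the window [-n, n] it is within 2np of sν + (1 -
s)μ (`abs_glueLaw_sub_le`). With p = εs(1 - s) this is a continuous path from μ to ν. For n = 0 the
error vanishes, so the drift is affine along the path and stays nonnegative; hence the path remains
continuous after rematching. As ν → μ and ε → 0 the whole path shrinks to μ
(`tendsto_ergodicInterpolate`), which gives the local statement.

Time reversal negates the drift and so handles nonpositive drift. A measure of zero drift links the
two halves; locally, the drift is continuous, so its sign is constant near μ unless it is zero at μ,
where both constructions apply. -/

namespace DyckMotzkin

variable {M N : ℕ}

/-! ### Heights and partners of brackets. -/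

/-- The height increment of a symbol. -/
def Letter.sgn : Letter M N → ℤ
  | left _ => 1
  | unit _ => 0
  | right _ => -1

theorem Letter.sgn_le_one (s : Letter M N) : s.sgn ≤ 1 := by cases s <;> simp [sgn]

theorem Letter.neg_one_le_sgn (s : Letter M N) : -1 ≤ s.sgn := by cases s <;> simp [sgn]

theorem Letter.sgn_eq_one {s : Letter M N} (h : s.sgn = 1) : ∃ a, s = left a := by
  cases s <;> simp_all [sgn]

/-- The increment of the height of `x` over the `k` symbols preceding the position `i`. -/
def back (x : ℤ → Letter M N) (i : ℤ) (k : ℕ) : ℤ :=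
  ∑ m ∈ Finset.range k, (x (i - 1 - m)).sgn

@[simp] theorem back_zero (x : ℤ → Letter M N) (i : ℤ) : back x i 0 = 0 := by simp [back]

theorem back_succ (x : ℤ → Letter M N) (i : ℤ) (k : ℕ) :
    back x i (k + 1) = back x i k + (x (i - 1 - k)).sgn := by
  simp [back, Finset.sum_range_succ]

theorem back_add (x : ℤ → Letter M N) (i : ℤ) (k l : ℕ) :
    back x i (k + l) = back x i k + back x (i - k) l := by
  induction l with
  | zero => simp
  | succ l ih =>
    rw [← add_assoc, back_succ, ih, back_succ, add_assoc]
    congr 4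
    push_cast
    ring

theorem back_one (x : ℤ → Letter M N) (i : ℤ) : back x i 1 = (x (i - 1)).sgn := by simp [back]

theorem back_succ' (x : ℤ → Letter M N) (i : ℤ) (k : ℕ) :
    back x (i + 1) (k + 1) = (x i).sgn + back x i k := by
  rw [add_comm k 1, back_add, back_one]
  simp

/-- Steps are at most 1, so a height cannot become positive without passing through 1. -/
theorem back_nonpos_of_ne_one {x : ℤ → Letter M N} {i : ℤ} {l : ℕ}
    (h : ∀ k ≤ l, back x i k ≠ 1) : back x i l ≤ 0 := by
  induction l with
  | zero => simp
  | succ l ih =>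
    have h1 := ih fun k hk => h k (by omega)
    have h2 := h (l + 1) le_rfl
    rw [back_succ] at h2 ⊢
    have := (x (i - 1 - l)).sgn_le_one
    omega

/-- The distance from the position `i` back to the nearest position at which a left bracket
is pending, or `0` if there is none. -/
noncomputable def matchDist (x : ℤ → Letter M N) (i : ℤ) : ℕ := sInf {k | back x i k = 1}

/-- At the first passage through 1 the last step goes up, so it is a left bracket, and the word
after it is balanced. -/
theorem exists_matchDist_eq {x : ℤ → Letter M N} {i : ℤ} (h : ∃ k, back x i k = 1) :
    ∃ n a, matchDist x i = n + 1 ∧ back x i n = 0 ∧ (∀ l ≤ n, back x i l ≤ 0) ∧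
      x (i - 1 - n) = Letter.left a := by
  have h1 : back x i (matchDist x i) = 1 := Nat.sInf_mem (s := {k | back x i k = 1}) h
  have h2 : ∀ l < matchDist x i, back x i l ≠ 1 := fun l hl => Nat.notMem_of_lt_sInf hl
  rcases hd : matchDist x i with _ | n
  · rw [hd] at h1
    simp at h1
  · rw [hd] at h1 h2
    have h3 : ∀ l ≤ n, back x i l ≤ 0 := fun l hl =>
      back_nonpos_of_ne_one fun k hk => h2 k (by omega)
    have h4 := h3 n le_rfl
    rw [back_succ] at h1
    have h5 := (x (i - 1 - n)).sgn_le_one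
    obtain ⟨a, ha⟩ := Letter.sgn_eq_one (s := x (i - 1 - n)) (by omega)
    exact ⟨n, a, rfl, by omega, h3, ha⟩

theorem matchDist_eq {x : ℤ → Letter M N} {i : ℤ} {n : ℕ} (h : ∀ l ≤ n, back x i l ≤ 0)
    (h1 : back x i (n + 1) = 1) : matchDist x i = n + 1 := by
  refine le_antisymm (Nat.sInf_le h1) (le_csInf ⟨n + 1, h1⟩ fun k hk => ?_)
  by_contra hkn
  have := h k (by omega)
  simp only [Set.mem_ofPred_eq] at hk
  omega

/-- Paired brackets of `x` carry the same index. -/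
def WellMatched (x : ℤ → Letter M N) : Prop :=
  ∀ (i : ℤ) (n : ℕ) (a b : Fin M), (∀ l ≤ n, back x i l ≤ 0) → back x i n = 0 →
    x (i - 1 - n) = Letter.left a → x i = Letter.right b → a = b

/-! ### Non-vanishing products -/

/-- The action of a word, read from right to left, on a stack of right brackets. A left bracket
that meets an empty stack leaves it empty. -/
def Letter.act : Letter M N → List (Fin M) → Option (List (Fin M))
  | left _, [] => some []
  | left a, c :: l => if a = c then some l else none
  | unit _, l => some l
  | right b, l => some (b :: l)

/-- The action of a word, as a hom. -/
def wordAct : FreeMonoid (Letter M N) →* Function.End (Option (List (Fin M))) :=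
  FreeMonoid.lift fun s o => o.bind s.act

theorem wordAct_of (s : Letter M N) (o : Option (List (Fin M))) :
    wordAct (FreeMonoid.of s) o = o.bind s.act :=
  congrFun (FreeMonoid.lift_eval_of (M := Function.End (Option (List (Fin M)))) _ s) o

theorem wordAct_none (w : FreeMonoid (Letter M N)) : wordAct w none = none := by
  induction w using FreeMonoid.inductionOn' with
  | one => rw [map_one]; rfl
  | of_mul s w ih =>
    rw [map_mul]
    change wordAct (FreeMonoid.of s) (wordAct w none) = none
    rw [ih, wordAct_of]
    rfl

/-- The action of the free monoid with zero; zero acts by the nowhere defined map. -/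
def zeroAct : WithZero (FreeMonoid (Letter M N)) →* Function.End (Option (List (Fin M))) where
  toFun a := WithZero.recZeroCoe (fun _ => none) (fun w => wordAct w) a
  map_one' := by
    change wordAct 1 = 1
    exact map_one _
  map_mul' a b := by
    induction a using WithZero.recZeroCoe with
    | zero => rw [zero_mul]; rfl
    | coe a =>
      induction b using WithZero.recZeroCoe with
      | zero =>
        rw [mul_zero]
        funext o
        exact (wordAct_none a).symm
      | coe b =>
        rw [← WithZero.coe_mul]
        exact map_mul wordAct a b

theorem zeroAct_gen (s : Letter M N) (o : Option (List (Fin M))) :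
    zeroAct (gen s) o = o.bind s.act := wordAct_of s o

/-- A generated congruence gives no direct handle on `≠ 0`. The stack action satisfies the relations
and lets 0 act as the nowhere defined map, so a word with a defined value is non-zero. -/
theorem bracketCon_le_ker : bracketCon M N ≤ Con.ker (zeroAct (M := M) (N := N)) := by
  refine Con.conGen_le.2 fun a b h => ?_
  rw [Con.ker_rel]
  funext o
  cases h with
  | match_eq i =>
    rw [map_mul, map_one]
    change zeroAct (gen _) (zeroAct (gen _) o) = o
    rw [zeroAct_gen, zeroAct_gen]
    cases o <;> simp [Letter.act]
  | mismatch i j h =>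
    rw [map_mul]
    change zeroAct (gen _) (zeroAct (gen _) o) = none
    rw [zeroAct_gen, zeroAct_gen]
    cases o <;> simp [Letter.act, h]
  | unit_eq l =>
    rw [map_one, zeroAct_gen]
    cases o <;> rfl

/-- The action of the bracket monoid. -/
def monoidAct : BracketMonoid M N →* Function.End (Option (List (Fin M))) :=
  (bracketCon M N).lift zeroAct bracketCon_le_ker

theorem monoidAct_red_cons (s : Letter M N) (w : List (Letter M N)) (o : Option (List (Fin M))) :
    monoidAct (red (s :: w)) o = (monoidAct (red w) o).bind s.act := by
  simp only [red, List.map_cons, List.prod_cons, map_mul]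
  exact zeroAct_gen _ _

theorem red_ne_zero_of_act {w : List (Letter M N)} {l m : List (Fin M)}
    (h : monoidAct (red w) (some l) = some m) : red w ≠ 0 := by
  intro h0
  rw [h0] at h
  exact Option.some_ne_none m h.symm

theorem zero_mul' (y : BracketMonoid M N) : 0 * y = 0 := by
  induction y using Con.induction_on with
  | _ y =>
    change ((0 : WithZero (FreeMonoid (Letter M N))) : (bracketCon M N).Quotient) * _ = _
    rw [← Con.coe_mul, zero_mul]
    rfl

theorem mul_zero' (y : BracketMonoid M N) : y * 0 = 0 := by
  induction y using Con.induction_on with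
  | _ y =>
    change _ * ((0 : WithZero (FreeMonoid (Letter M N))) : (bracketCon M N).Quotient) = _
    rw [← Con.coe_mul, mul_zero]
    rfl

theorem red_cons (s : Letter M N) (w : List (Letter M N)) : red (s :: w) = red [s] * red w := by
  simp [red]

theorem red_left_right_self (a : Fin M) :
    red [Letter.left a] * red [Letter.right a] = (1 : BracketMonoid M N) := by
  simp only [red, List.map_cons, List.map_nil, List.prod_cons, List.prod_nil, mul_one]
  exact (Con.eq _).2 (ConGen.Rel.of _ _ (Rel.match_eq a))

theorem red_left_right_of_ne {a b : Fin M} (h : a ≠ b) :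
    red [Letter.left a] * red [Letter.right b] = (0 : BracketMonoid M N) := by
  simp only [red, List.map_cons, List.map_nil, List.prod_cons, List.prod_nil, mul_one]
  exact (Con.eq _).2 (ConGen.Rel.of _ _ (Rel.mismatch a b h))

theorem red_unit (l : Fin N) : red [Letter.unit l] = (1 : BracketMonoid M N) := by
  simp only [red, List.map_cons, List.map_nil, List.prod_cons, List.prod_nil, mul_one]
  exact (Con.eq _).2 (ConGen.Rel.of _ _ (Rel.unit_eq l))

/-- The `n` symbols preceding the position `i`. -/
def seg (x : ℤ → Letter M N) (i : ℤ) : ℕ → List (Letter M N)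
  | 0 => []
  | n + 1 => x (i - 1 - n) :: seg x i n

theorem block_eq_seg (x : ℤ → Letter M N) (j k : ℤ) :
    block x j k = seg x (k + 1) (k + 1 - j).toNat := by
  have key : ∀ (n : ℕ) (i : ℤ),
      (List.range n).map (fun m : ℕ => x (i - n + m)) = seg x i n := by
    intro n i
    induction n with
    | zero => rfl
    | succ n ih =>
      rw [List.range_succ_eq_map, List.map_cons, seg, ← ih, List.map_map]
      congr 1
      · congr 1; push_cast; ring
      · refine List.map_congr_left fun m _ => ?_
        simp only [Function.comp_apply]
        congr 1; push_cast; ring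
  rcases le_total j (k + 1) with h | h
  · rw [← key, block]
    refine List.map_congr_left fun m _ => ?_
    congr 1
    rw [Int.toNat_of_nonneg (by linarith)]
    ring
  · rw [Int.toNat_of_nonpos (by linarith), block, Int.toNat_of_nonpos (by linarith)]
    rfl

/-- Reading leftwards, each left bracket meets a pending right bracket because no suffix has
positive height. Either some pair clashes, or only right brackets survive. -/
theorem red_seg_of_back_nonpos (x : ℤ → Letter M N) (i : ℤ) (n : ℕ)
    (h : ∀ l ≤ n, back x i l ≤ 0) :
    red (seg x i n) = 0 ∨ ∃ bs : List (Fin M), (bs.length : ℤ) = -back x i n ∧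
      red (seg x i n) = red (bs.map Letter.right) := by
  induction n with
  | zero => exact Or.inr ⟨[], by simp, rfl⟩
  | succ n ih =>
    rw [seg, red_cons]
    rcases ih fun l hl => h l (by omega) with h0 | ⟨bs, hbs, hr⟩
    · left
      rw [h0, mul_zero']
    · have h1 := h (n + 1) le_rfl
      rw [back_succ] at h1 ⊢
      rw [hr]
      cases hx : x (i - 1 - n) with
      | left a =>
        rw [hx] at h1
        simp only [Letter.sgn] at h1 ⊢
        cases bs with
        | nil => simp at hbs; omega
        | cons b bs =>
          rw [List.map_cons, red_cons (Letter.right b), ← mul_assoc]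
          rcases eq_or_ne a b with rfl | hab
          · right
            refine ⟨bs, ?_, by rw [red_left_right_self, one_mul]⟩
            simp at hbs
            omega
          · left
            rw [red_left_right_of_ne hab, zero_mul']
      | unit l =>
        right
        exact ⟨bs, by simp [hbs, Letter.sgn], by rw [red_unit, one_mul]⟩
      | right b =>
        right
        refine ⟨b :: bs, ?_, by rw [List.map_cons, red_cons (Letter.right b) (bs.map _)]⟩
        simp [hbs, Letter.sgn]
        ring

/-- The word between two partners is balanced, so it reduces to 0 or 1; flanked by brackets of
different indices it yields 0. -/
theorem WellMatched.of_mem {x : ℤ → Letter M N} (hx : x ∈ dyckMotzkinShift M N) :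
    WellMatched x := by
  intro i n a b h h0 ha hb
  by_contra hab
  have hne := hx (i - 1 - n) i (by linarith [Int.natCast_nonneg n])
  rw [block_eq_seg, show (i + 1 - (i - 1 - n)).toNat = n + 2 by omega] at hne
  apply hne
  have hseg : ∀ m, red (seg x (i + 1) (m + 1)) = red (seg x i m) * red [Letter.right b] := by
    intro m
    induction m with
    | zero => simp [seg, hb, red]
    | succ m ih =>
      rw [seg, red_cons, ih, seg, red_cons (x (i - 1 - m)), mul_assoc]
      congr 4
      push_cast
      ring
  rw [hseg, seg, red_cons, ha]
  rcases red_seg_of_back_nonpos x i n h with h1 | ⟨bs, hl, h1⟩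
  · rw [h1, mul_zero', zero_mul']
  · rw [h0] at hl
    obtain rfl : bs = [] := by simpa using hl
    rw [h1]
    simp only [List.map_nil]
    rw [show red ([] : List (Letter M N)) = 1 from rfl, mul_one, red_left_right_of_ne hab]

/-- The stack `l` records, from the position `j` on, right brackets of `x` that are separated by
balanced words. -/
def StackAt (x : ℤ → Letter M N) : List (Fin M) → ℤ → Prop
  | [], _ => True
  | c :: l, j => ∃ m : ℕ, (∀ k ≤ m, back x (j + m) k ≤ 0) ∧ back x (j + m) m = 0 ∧
      x (j + m) = Letter.right c ∧ StackAt x l (j + m + 1)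

/-- Only a pop can fail, and the top of the stack is the partner by height of the left bracket that
pops it. -/
theorem StackAt.step {x : ℤ → Letter M N} (hx : WellMatched x) {l : List (Fin M)} {j : ℤ}
    (h : StackAt x l (j + 1)) : ∃ l', (x j).act l = some l' ∧ StackAt x l' j := by
  cases hxj : x j with
  | left a =>
    cases l with
    | nil => exact ⟨[], rfl, trivial⟩
    | cons c l =>
      obtain ⟨m, h1, h2, h3, h4⟩ := h
      have hac : a = c := hx (j + 1 + m) m a c h1 h2 (by rw [← hxj]; congr 1; ring) h3
      refine ⟨l, by simp [Letter.act, hac], ?_⟩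
      cases l with
      | nil => trivial
      | cons d l =>
        obtain ⟨m', h1', h2', h3', h4'⟩ := h4
        -- After the pop, the matched pair with its interior of length m joins the balanced word of
        -- length m' before the next stack entry.
        have e1 : j + 1 + m + 1 + m' = j + ((m + m' + 2 : ℕ) : ℤ) := by push_cast; ring
        have key : ∀ k ≤ m, back x (j + 1 + m + 1 + m') (m' + (k + 1)) ≤ -1 := by
          intro k hk
          rw [back_add, h2', add_sub_cancel_right, back_succ', h3]
          have := h1 k hk
          simp only [Letter.sgn]
          omega
        have key' : back x (j + 1 + m + 1 + m') (m' + (m + 1) + 1) = 0 := by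
          rw [back_succ, back_add, h2', add_sub_cancel_right, back_succ', h3, h2,
            show j + 1 + m + 1 + m' - 1 - ((m' + (m + 1) : ℕ) : ℤ) = j by push_cast; ring, hxj]
          simp [Letter.sgn]
        refine ⟨m + m' + 2, ?_, ?_, ?_, ?_⟩
        · intro k hk
          rw [← e1]
          rcases le_or_gt k m' with hkm | hkm
          · exact h1' k hkm
          · obtain ⟨r, rfl⟩ := Nat.exists_eq_add_of_lt hkm
            rcases le_or_gt r m with hr | hr
            · exact (key r hr).trans (by norm_num)
            · obtain rfl : r = m + 1 := by omega
              exact key'.le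
        · rw [← e1, show m + m' + 2 = m' + (m + 1) + 1 by ring]
          exact key'
        · rw [← e1]; exact h3'
        · rw [← e1]; exact h4'
  | unit r =>
    refine ⟨l, rfl, ?_⟩
    cases l with
    | nil => trivial
    | cons c l =>
      obtain ⟨m, h1, h2, h3, h4⟩ := h
      have e1 : j + 1 + m = j + ((m + 1 : ℕ) : ℤ) := by push_cast; ring
      have key : back x (j + 1 + m) (m + 1) = 0 := by
        rw [back_succ, h2, show j + 1 + (m : ℤ) - 1 - m = j by ring, hxj]
        rfl
      refine ⟨m + 1, fun k hk => ?_, ?_, ?_, ?_⟩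
      · rw [← e1]
        rcases Nat.of_le_succ hk with hk | rfl
        · exact h1 k hk
        · exact key.le
      · rw [← e1, key]
      · rw [← e1, h3]
      · rw [← e1]; exact h4
  | right b =>
    refine ⟨b :: l, rfl, 0, ?_, ?_, ?_, ?_⟩
    · intro k hk
      obtain rfl : k = 0 := by omega
      simp
    · simp
    · simpa using hxj
    · simpa using h

theorem WellMatched.mem {x : ℤ → Letter M N} (hx : WellMatched x) :
    x ∈ dyckMotzkinShift M N := by
  intro j k _
  rw [block_eq_seg]
  have key : ∀ n : ℕ, ∃ l, monoidAct (red (seg x (k + 1) n)) (some []) = some l ∧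
      StackAt x l (k + 1 - n) := by
    intro n
    induction n with
    | zero =>
      refine ⟨[], ?_, trivial⟩
      rw [seg, show red ([] : List (Letter M N)) = 1 from rfl, map_one]
      rfl
    | succ n ih =>
      obtain ⟨l, h1, h2⟩ := ih
      rw [seg, monoidAct_red_cons, h1]
      have e : k + 1 - ((n + 1 : ℕ) : ℤ) = k + 1 - 1 - n := by push_cast; ring
      rw [e]
      exact StackAt.step hx (by convert h2 using 1; ring)
  obtain ⟨l, h, -⟩ := key (k + 1 - j).toNat
  exact red_ne_zero_of_act h

/-! ### Rematching -/

/-- The symbol `s`, where a right bracket receives the index of the left bracket `t`. -/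
def Letter.recolor : Letter M N → Letter M N → Letter M N
  | left a, right _ => right a
  | _, s => s

@[simp] theorem Letter.sgn_recolor (t s : Letter M N) : (recolor t s).sgn = s.sgn := by
  cases t <;> cases s <;> rfl

@[simp] theorem Letter.recolor_self (s : Letter M N) : recolor s s = s := by cases s <;> rfl

/-- Give to every right bracket the index of its partner. -/
noncomputable def rematchFun (x : ℤ → Letter M N) : ℤ → Letter M N :=
  fun i => (x (i - matchDist x i)).recolor (x i)

theorem back_rematchFun (x : ℤ → Letter M N) (i : ℤ) (k : ℕ) :
    back (rematchFun x) i k = back x i k := by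
  simp [back, rematchFun]

/-- Rematching changes no height and no left bracket, so partners are the same before and after. -/
theorem wellMatched_rematchFun (x : ℤ → Letter M N) : WellMatched (rematchFun x) := by
  intro i n a b h h0 ha hb
  simp only [back_rematchFun] at h h0
  have hl : x (i - 1 - n) = Letter.left a := by
    revert ha
    unfold rematchFun
    cases x (i - 1 - n - matchDist x (i - 1 - n)) <;> cases x (i - 1 - n) <;>
      simp [Letter.recolor]
  have hd : matchDist x i = n + 1 := matchDist_eq h (by rw [back_succ, h0, hl]; rfl)
  rw [rematchFun, hd, show i - ((n + 1 : ℕ) : ℤ) = i - 1 - n by push_cast; ring, hl] at hb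
  cases hxi : x i <;> simp_all [Letter.recolor]

theorem WellMatched.rematchFun_eq {x : ℤ → Letter M N} (hx : WellMatched x) :
    rematchFun x = x := by
  funext i
  unfold rematchFun
  by_cases h : ∃ k, back x i k = 1
  · obtain ⟨n, a, hd, h0, hle, ha⟩ := exists_matchDist_eq h
    rw [hd, show i - ((n + 1 : ℕ) : ℤ) = i - 1 - n by push_cast; ring, ha]
    cases hxi : x i with
    | left c => rfl
    | unit c => rfl
    | right c => rw [hx i n a c hle h0 ha hxi]; rfl
  -- Without a partner, `sInf ∅ = 0` makes the symbol recolor itself, which has no effect.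
  · have : matchDist x i = 0 := by
      unfold matchDist
      rw [Nat.sInf_eq_zero]
      right
      ext k
      simpa using fun hk => h ⟨k, hk⟩
    simp [this]

/-- The retraction of the full shift onto the Dyck-Motzkin shift. -/
noncomputable def rematch (x : ℤ → Letter M N) : dyckMotzkinShift M N :=
  ⟨rematchFun x, (wellMatched_rematchFun x).mem⟩

@[simp] theorem rematch_coe (x : dyckMotzkinShift M N) : rematch (x : ℤ → Letter M N) = x :=
  Subtype.ext (WellMatched.of_mem x.2).rematchFun_eq

theorem back_leftShift (x : ℤ → Letter M N) (i : ℤ) (k : ℕ) :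
    back (leftShift x) i k = back x (i + 1) k := by
  unfold back leftShift
  refine Finset.sum_congr rfl fun m _ => ?_
  congr 2
  ring

theorem rematch_semiconj : Function.Semiconj (rematch (M := M) (N := N)) leftShift (shift M N) := by
  intro x
  refine Subtype.ext (funext fun i => ?_)
  change rematchFun (leftShift x) i = rematchFun x (i + 1)
  have : matchDist (leftShift x) i = matchDist x (i + 1) := by
    simp only [matchDist, back_leftShift]
  unfold rematchFun
  rw [this]
  unfold leftShift
  congr 2
  ring

/-! ### Time reversal -/

/-- Exchange left and right brackets. -/
def Letter.swap : Letter M N → Letter M N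
  | left a => right a
  | unit l => unit l
  | right a => left a

@[simp] theorem Letter.swap_swap (s : Letter M N) : s.swap.swap = s := by cases s <;> rfl

@[simp] theorem Letter.sgn_swap (s : Letter M N) : s.swap.sgn = -s.sgn := by cases s <;> rfl

/-- Read a sequence backwards and exchange left and right brackets. -/
def revFun (x : ℤ → Letter M N) : ℤ → Letter M N := fun i => (x (-i)).swap

theorem back_revFun (x : ℤ → Letter M N) (i : ℤ) (k : ℕ) :
    back (revFun x) i k = -back x (-i + 1 + k) k := by
  unfold back revFun
  rw [← Finset.sum_neg_distrib, ← Finset.sum_range_reflect]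
  refine Finset.sum_congr rfl fun m hm => ?_
  rw [Letter.sgn_swap]
  congr 3
  have := Finset.mem_range.1 hm
  omega

/-- In a word of total height 0, a suffix of nonpositive height is complementary to a prefix of
nonnegative height, which reversal with swapping turns into a suffix of nonpositive height. -/
theorem WellMatched.revFun {x : ℤ → Letter M N} (hx : WellMatched x) :
    WellMatched (revFun x) := by
  intro i n a b h h0 ha hb
  have ha' : x (-i + 1 + n) = Letter.right a := by
    rw [← Letter.swap_swap (x _), ← show DyckMotzkin.revFun x (i - 1 - n) = (x (-i + 1 + n)).swap by
      unfold DyckMotzkin.revFun; congr 2; ring, ha]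
    rfl
  have hb' : x (-i) = Letter.left b := by
    rw [← Letter.swap_swap (x _)]
    change (DyckMotzkin.revFun x i).swap = _
    rw [hb]
    rfl
  rw [back_revFun] at h0
  refine (hx (-i + 1 + n) n b a ?_ (by omega) (by rw [← hb']; congr 1; ring) ha').symm
  intro l hl
  have h1 := h (n - l) (by omega)
  rw [back_revFun] at h1
  have h2 := back_add x (-i + 1 + n) l (n - l)
  rw [Nat.add_sub_of_le hl, show (-i + 1 + n - l : ℤ) = -i + 1 + ((n - l : ℕ) : ℤ) by omega] at h2
  omega

/-- Time reversal of the Dyck-Motzkin shift. -/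
def rev (x : dyckMotzkinShift M N) : dyckMotzkinShift M N :=
  ⟨revFun x, (WellMatched.of_mem x.2).revFun.mem⟩

@[simp] theorem rev_rev (x : dyckMotzkinShift M N) : rev (rev x) = x := by
  refine Subtype.ext (funext fun i => ?_)
  simp [rev, revFun]

/-- This says that `rev` conjugates the shift to its inverse, without naming the inverse. -/
theorem shift_rev_shift (x : dyckMotzkinShift M N) : shift M N (rev (shift M N x)) = rev x := by
  refine Subtype.ext (funext fun i => ?_)
  change (x.1 (-(i + 1) + 1)).swap = (x.1 (-i)).swap
  rw [show -(i + 1) + 1 = -i by ring]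

open Filter Topology Set
open scoped Pointwise unitInterval

/-! ### Measurability and continuity of rematching -/

section Shift

variable {S : Type*}

theorem leftShift_iterate (n : ℕ) (x : ℤ → S) (i : ℤ) : leftShift^[n] x i = x (i + n) := by
  induction n generalizing i with
  | zero => simp
  | succ n ih =>
    rw [Function.iterate_succ_apply']
    change leftShift^[n] x (i + 1) = _
    rw [ih]
    congr 1
    push_cast
    ring

theorem measurable_leftShift [MeasurableSpace S] :
    Measurable (leftShift : (ℤ → S) → (ℤ → S)) :=
  measurable_pi_lambda _ fun i => measurable_pi_apply (i + 1)

end Shift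

theorem measurable_sInf_nat {α : Type*} [MeasurableSpace α] {p : ℕ → α → Prop}
    (hp : ∀ k, MeasurableSet {x | p k x}) : Measurable fun x => sInf {k | p k x} := by
  classical
  -- The second alternative makes `Nat.find` return 0 when no `p l x` holds, in agreement with `sInf
  -- ∅ = 0`.
  have h : ∀ x, ∃ k, p k x ∨ ∀ l, ¬p l x := fun x => by
    by_cases h : ∃ k, p k x
    · exact ⟨h.choose, Or.inl h.choose_spec⟩
    · exact ⟨0, Or.inr (not_exists.1 h)⟩
  have hm : ∀ k, MeasurableSet {x | p k x ∨ ∀ l, ¬p l x} := fun k => by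
    rw [show {x | p k x ∨ ∀ l, ¬p l x} = {x | p k x} ∪ ⋂ l, {x | p l x}ᶜ by ext; simp]
    exact (hp k).union (MeasurableSet.iInter fun l => (hp l).compl)
  convert measurable_find h hm using 2 with x
  by_cases hx : ∃ k, p k x
  · refine le_antisymm (Nat.sInf_le ?_) (Nat.find_min' (h x) (Or.inl (Nat.sInf_mem hx)))
    exact (Nat.find_spec (h x)).resolve_right fun h' => h' _ hx.choose_spec
  · rw [(Nat.find_eq_zero (h x)).2 (Or.inr (not_exists.1 hx)), Nat.sInf_eq_zero]
    right
    ext k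
    simpa using fun hk => hx ⟨k, hk⟩

theorem measurable_back (i : ℤ) (k : ℕ) :
    Measurable fun x : ℤ → Letter M N => back x i k :=
  Finset.measurable_sum _ fun _ _ =>
    (measurable_of_countable Letter.sgn).comp (measurable_pi_apply _)

theorem measurable_matchDist (i : ℤ) :
    Measurable fun x : ℤ → Letter M N => matchDist x i :=
  measurable_sInf_nat fun k => measurable_back i k (measurableSet_singleton 1)

theorem measurable_rematchFun : Measurable (rematchFun (M := M) (N := N)) := by
  refine measurable_pi_lambda _ fun i => ?_
  have h1 : Measurable fun p : (ℤ → Letter M N) × ℕ => (p.1 (i - p.2), p.1 i) :=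
    measurable_from_prod_countable_left fun n =>
      (measurable_pi_apply (i - (n : ℤ))).prodMk (measurable_pi_apply i)
  exact (measurable_of_countable fun p : Letter M N × Letter M N => p.1.recolor p.2).comp
    (h1.comp (measurable_id.prodMk (measurable_matchDist i)))

theorem measurable_rematch : Measurable (rematch (M := M) (N := N)) :=
  measurable_rematchFun.subtype_mk

/-- Every right bracket of `x` has a partner. -/
def RightMatched (x : ℤ → Letter M N) : Prop :=
  ∀ i b, x i = Letter.right b → ∃ k, back x i k = 1

theorem eventually_apply_eq (x : ℤ → Letter M N) (i : ℤ) : ∀ᶠ y in 𝓝 x, y i = x i :=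
  (continuous_apply i).continuousAt (isOpen_discrete {x i} |>.mem_nhds rfl)

theorem Letter.recolor_of_forall_ne_right (t : Letter M N) {s : Letter M N}
    (h : ∀ b, s ≠ right b) : recolor t s = s := by
  cases s with
  | right b => exact absurd rfl (h b)
  | _ => cases t <;> rfl

/-- The index given to a matched right bracket depends only on the symbols back to its partner,
whereas an unmatched one would require the whole past. -/
theorem RightMatched.continuousAt_rematch {x : ℤ → Letter M N} (hx : RightMatched x) :
    ContinuousAt rematch x := by
  rw [Topology.IsInducing.subtypeVal.continuousAt_iff, continuousAt_pi]
  intro i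
  refine ContinuousAt.congr (f := fun _ => rematchFun x i) continuousAt_const ?_
  change ∀ᶠ y in 𝓝 x, rematchFun x i = rematchFun y i
  cases hxi : x i with
  | left a =>
    filter_upwards [eventually_apply_eq x i] with y hy
    simp only [rematchFun, hy, hxi]
    rw [Letter.recolor_of_forall_ne_right _ (by simp),
      Letter.recolor_of_forall_ne_right _ (by simp)]
  | unit a =>
    filter_upwards [eventually_apply_eq x i] with y hy
    simp only [rematchFun, hy, hxi]
    rw [Letter.recolor_of_forall_ne_right _ (by simp),
      Letter.recolor_of_forall_ne_right _ (by simp)]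
  | right b =>
    obtain ⟨n, a, hd, h0, hle, ha⟩ := exists_matchDist_eq (hx i b hxi)
    have hev : ∀ᶠ y in 𝓝 x, ∀ m ∈ Finset.range (n + 1), y (i - 1 - m) = x (i - 1 - m) :=
      (Finset.eventually_all _).2 fun m _ => eventually_apply_eq x _
    filter_upwards [hev, eventually_apply_eq x i] with y hy hyi
    have hb : ∀ l ≤ n + 1, back y i l = back x i l := fun l hl =>
      Finset.sum_congr rfl fun m hm => by
        rw [hy m (Finset.mem_range.2 (by have := Finset.mem_range.1 hm; omega))]
    have hd' : matchDist y i = n + 1 := by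
      refine matchDist_eq (fun l hl => by rw [hb l (by omega)]; exact hle l hl) ?_
      rw [hb _ le_rfl, back_succ, h0, ha]
      rfl
    unfold rematchFun
    rw [hd, hd', hyi, show i - ((n + 1 : ℕ) : ℤ) = i - 1 - n by push_cast; ring,
      hy n (by simp)]

/-! ### Matching under a nonnegative drift -/

/-- The height of `x` at the origin above its past infimum. -/
noncomputable def backSup (x : ℤ → Letter M N) : ℝ := ⨆ k, (back x 0 k : ℝ)

/-- The past heights of `x` are bounded below. -/
def backBdd (M N : ℕ) : Set (ℤ → Letter M N) := {x | BddAbove (range fun k => (back x 0 k : ℝ))}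

theorem measurable_back_real (i : ℤ) (k : ℕ) :
    Measurable fun x : ℤ → Letter M N => (back x i k : ℝ) :=
  (measurable_of_countable (Int.cast : ℤ → ℝ)).comp (measurable_back i k)

theorem measurable_backSup : Measurable (backSup (M := M) (N := N)) :=
  Measurable.iSup fun k => measurable_back_real 0 k

theorem measurableSet_backBdd : MeasurableSet (backBdd M N) :=
  measurableSet_bddAbove_range fun k => measurable_back_real 0 k

theorem leftShift_preimage_backBdd : leftShift ⁻¹' backBdd M N = backBdd M N := by
  ext x
  simp only [backBdd, mem_preimage, mem_ofPred_eq, back_leftShift]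
  constructor
  · rintro ⟨C, hC⟩
    refine ⟨C - (x 0).sgn, ?_⟩
    rintro _ ⟨k, rfl⟩
    have := hC ⟨k + 1, rfl⟩
    simp only [back_succ'] at this
    push_cast at this
    dsimp only
    linarith
  · rintro ⟨C, hC⟩
    refine ⟨max 0 (C + (x 0).sgn), ?_⟩
    rintro _ ⟨k, rfl⟩
    rcases k with _ | k
    · simp
    · have := hC ⟨k, rfl⟩
      dsimp only at this ⊢
      rw [back_succ']
      push_cast
      exact le_max_of_le_right (by linarith)

theorem backSup_nonneg (x : ℤ → Letter M N) : 0 ≤ backSup x := by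
  by_cases h : x ∈ backBdd M N
  · exact le_ciSup_of_le h 0 (by simp)
  · exact (Real.iSup_of_not_bddAbove h).ge

/-- The sequences that have an unmatched right bracket at `i`. -/
def unmatchedAt (M N : ℕ) (i : ℤ) : Set (ℤ → Letter M N) :=
  {x | (∀ k, back x i k ≤ 0) ∧ (x i).sgn = -1}

theorem measurableSet_unmatchedAt (i : ℤ) : MeasurableSet (unmatchedAt M N i) :=
  (show MeasurableSet {x : ℤ → Letter M N | ∀ k, back x i k ≤ 0} by
    simpa only [ofPred_forall] using!
      MeasurableSet.iInter fun k => measurable_back i k (measurableSet_Iic (a := 0))).inter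
    (((measurable_of_countable Letter.sgn).comp (measurable_pi_apply i))
      (measurableSet_singleton _))

theorem leftShift_preimage_unmatchedAt (i : ℤ) :
    leftShift ⁻¹' unmatchedAt M N i = unmatchedAt M N (i + 1) := by
  ext x
  simp only [unmatchedAt, mem_preimage, mem_ofPred_eq, back_leftShift]
  rfl

/-- The height above the past infimum is a walk reflected at 0, and the reflection acts exactly at
unmatched right brackets. -/
theorem backSup_leftShift_sub {x : ℤ → Letter M N} (hx : x ∈ backBdd M N) :
    backSup (leftShift x) - backSup x =
      (x 0).sgn + (unmatchedAt M N 0).indicator (fun _ => (1 : ℝ)) x := by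
  have hx' : leftShift x ∈ backBdd M N := by
    rw [← leftShift_preimage_backBdd] at hx
    exact hx
  have h0 := backSup_nonneg x
  have hmax : backSup (leftShift x) = max 0 ((x 0).sgn + backSup x) := by
    refine le_antisymm (ciSup_le fun k => ?_) (max_le (backSup_nonneg _) ?_)
    · rw [back_leftShift]
      rcases k with _ | k
      · simp
      · rw [back_succ']
        push_cast
        refine le_max_of_le_right ?_
        gcongr
        exact le_ciSup hx k
    · rw [← le_sub_iff_add_le']
      refine ciSup_le fun k => ?_
      rw [le_sub_iff_add_le']
      refine le_ciSup_of_le hx' (k + 1) ?_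
      rw [back_leftShift, back_succ']
      push_cast
      rfl
  rw [hmax]
  by_cases hs : (x 0).sgn = -1
  · by_cases hu : ∀ k, back x 0 k ≤ 0
    · have : backSup x = 0 := le_antisymm (ciSup_le fun k => by exact_mod_cast hu k) h0
      rw [indicator_of_mem (show x ∈ unmatchedAt M N 0 from ⟨hu, hs⟩), this, hs]
      norm_num
    · rw [indicator_of_notMem (fun h => hu h.1), hs]
      push Not at hu
      obtain ⟨k, hk⟩ := hu
      have : (1 : ℝ) ≤ backSup x := le_ciSup_of_le hx k (by exact_mod_cast hk)
      rw [max_eq_right (by push_cast; linarith)]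
      push_cast
      ring
  · have h1 : (0 : ℝ) ≤ (x 0).sgn := by
      have := (x 0).neg_one_le_sgn
      exact_mod_cast (by omega : 0 ≤ (x 0).sgn)
    rw [indicator_of_notMem (fun h => hs h.2), max_eq_right (by linarith)]
    ring

theorem abs_sgn_le_one (s : Letter M N) : |(s.sgn : ℝ)| ≤ 1 := by
  have h1 := s.sgn_le_one
  have h2 := s.neg_one_le_sgn
  exact abs_le.2 ⟨by exact_mod_cast h2, by exact_mod_cast h1⟩

theorem abs_backSup_leftShift_sub_le (x : ℤ → Letter M N) :
    |backSup (leftShift x) - backSup x| ≤ 1 := by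
  by_cases hx : x ∈ backBdd M N
  · rw [backSup_leftShift_sub hx]
    by_cases hu : x ∈ unmatchedAt M N 0
    · rw [indicator_of_mem hu, hu.2]
      norm_num
    · rw [indicator_of_notMem hu, add_zero]
      exact abs_sgn_le_one _
  -- Off the invariant set `backBdd` both suprema take the default value 0.
  · have hx' : leftShift x ∉ backBdd M N := by
      rw [← leftShift_preimage_backBdd] at hx
      exact hx
    rw [backSup, backSup, Real.iSup_of_not_bddAbove hx, Real.iSup_of_not_bddAbove hx']
    norm_num

/-- A coboundary that is bounded has integral zero, even if its transfer function is not
integrable. -/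
theorem integral_comp_sub_eq_zero {X : Type*} [MeasurableSpace X] {μ : Measure X}
    [IsProbabilityMeasure μ] {T : X → X} (hT : MeasurePreserving T μ μ) {f : X → ℝ}
    (hf : Measurable f) (hf0 : 0 ≤ f) {C : ℝ} (hC : ∀ x, |f (T x) - f x| ≤ C) :
    ∫ x, (f (T x) - f x) ∂μ = 0 := by
  -- Truncate at K: by invariance the truncated coboundary has integral zero, and it stays bounded
  -- by C, so dominated convergence applies.
  have hmeas : ∀ K : ℕ, Measurable fun x => min (f x) K := fun K => hf.min measurable_const
  have hint : ∀ K : ℕ, Integrable (fun x => min (f x) K) μ := fun K =>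
    Integrable.of_bound (hmeas K).aestronglyMeasurable K (ae_of_all _ fun x => by
      rw [Real.norm_of_nonneg (le_min (hf0 x) (Nat.cast_nonneg K))]
      exact min_le_right _ _)
  have hzero : ∀ K : ℕ, ∫ x, (min (f (T x)) K - min (f x) K) ∂μ = 0 := fun K => by
    have h1 : Integrable (fun x => min (f (T x)) K) μ := hT.integrable_comp_of_integrable (hint K)
    rw [integral_sub h1 (hint K), sub_eq_zero]
    have h2 := integral_map (f := fun x => min (f x) (K : ℝ)) hT.aemeasurable
      (hmeas K).aestronglyMeasurable
    rw [hT.map_eq] at h2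
    exact h2.symm
  have hlim : Tendsto (fun K : ℕ => ∫ x, (min (f (T x)) K - min (f x) K) ∂μ) atTop
      (𝓝 (∫ x, (f (T x) - f x) ∂μ)) := by
    refine tendsto_integral_of_dominated_convergence (fun _ => C) ?_ (integrable_const C) ?_ ?_
    · exact fun K => (((hmeas K).comp hT.measurable).sub (hmeas K)).aestronglyMeasurable
    · intro K
      refine ae_of_all _ fun x => ?_
      refine (abs_min_sub_min_le_max _ _ _ _).trans ?_
      exact max_le (hC x) (by simpa using (abs_nonneg _).trans (hC x))
    · refine ae_of_all _ fun x => tendsto_const_nhds.congr' ?_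
      filter_upwards [tendsto_natCast_atTop_atTop.eventually_ge_atTop (max (f (T x)) (f x))]
        with K hK
      rw [min_eq_left ((le_max_left _ _).trans hK), min_eq_left ((le_max_right _ _).trans hK)]
  simp only [hzero] at hlim
  exact tendsto_nhds_unique hlim tendsto_const_nhds

theorem measurable_sgn_apply (i : ℤ) :
    Measurable fun x : ℤ → Letter M N => ((x i).sgn : ℝ) :=
  (measurable_of_countable fun s : Letter M N => (s.sgn : ℝ)).comp (measurable_pi_apply i)

theorem integrable_sgn_apply (κ : Measure (ℤ → Letter M N)) [IsProbabilityMeasure κ] (i : ℤ) :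
    Integrable (fun x : ℤ → Letter M N => ((x i).sgn : ℝ)) κ :=
  Integrable.of_bound (measurable_sgn_apply i).aestronglyMeasurable 1
    (ae_of_all _ fun _ => abs_sgn_le_one _)

/-- By ergodicity, past heights are bounded below almost surely or almost never. In the second case
an unmatched right bracket is impossible; in the first, integrating the increment of `backSup` gives
drift + P(unmatched) = 0, so both terms vanish. -/
theorem ae_rightMatched {κ : Measure (ℤ → Letter M N)} [IsProbabilityMeasure κ]
    (hκ : Ergodic leftShift κ) (hd : 0 ≤ ∫ x, ((x 0).sgn : ℝ) ∂κ) :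
    ∀ᵐ x ∂κ, RightMatched x := by
  have h0 : κ (unmatchedAt M N 0) = 0 := by
    rcases hκ.toPreErgodic.prob_eq_zero_or_one measurableSet_backBdd leftShift_preimage_backBdd
      with h | h
    · refine measure_mono_null (fun x hx => ?_) h
      refine ⟨0, ?_⟩
      rintro _ ⟨k, rfl⟩
      exact Int.cast_nonpos.2 (hx.1 k)
    · have h1 := integral_comp_sub_eq_zero hκ.toMeasurePreserving measurable_backSup
        backSup_nonneg abs_backSup_leftShift_sub_le
      have h2 : ∀ᵐ x ∂κ, x ∈ backBdd M N := (prob_compl_eq_zero_iff measurableSet_backBdd).2 h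
      have hm := measurableSet_unmatchedAt (M := M) (N := N) 0
      rw [integral_congr_ae (h2.mono fun x hx => backSup_leftShift_sub hx),
        integral_add (integrable_sgn_apply κ 0)
          ((integrable_const (1 : ℝ)).indicator hm), integral_indicator hm] at h1
      simp only [integral_const, smul_eq_mul, mul_one, MeasurableSet.univ,
        measureReal_restrict_apply, univ_inter] at h1
      have h3 : κ.real (unmatchedAt M N 0) = 0 :=
        le_antisymm (by linarith) measureReal_nonneg
      exact (measureReal_eq_zero_iff).1 h3
  have hstep : ∀ i, κ (unmatchedAt M N (i + 1)) = κ (unmatchedAt M N i) := fun i => by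
    rw [← leftShift_preimage_unmatchedAt]
    exact hκ.measure_preimage (measurableSet_unmatchedAt i).nullMeasurableSet
  have hall : ∀ i, κ (unmatchedAt M N i) = 0 := by
    intro i
    induction i with
    | zero => exact h0
    | succ i ih => rw [hstep, ih]
    | pred i ih => rw [← hstep, sub_add_cancel, ih]
  have hae : ∀ᵐ x ∂κ, ∀ i, x ∉ unmatchedAt M N i :=
    ae_all_iff.2 fun i => measure_eq_zero_iff_ae_notMem.1 (hall i)
  filter_upwards [hae] with x hx i b hb
  by_contra hk
  exact hx i ⟨fun k => back_nonpos_of_ne_one fun l _ hl => hk ⟨l, hl⟩, by rw [hb]; rfl⟩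

/-! ### Ergodicity of Bernoulli shifts -/

/-- A map that is mixing along a generating π-system is ergodic. -/
theorem ergodic_of_tendsto_piSystem {X : Type*} [mX : MeasurableSpace X] {μ : Measure X}
    [IsProbabilityMeasure μ] {T : X → X} (hT : MeasurePreserving T μ μ) {C : Set (Set X)}
    (hgen : mX = MeasurableSpace.generateFrom C) (hC : IsPiSystem C)
    (hmix : ∀ A ∈ C, ∀ B ∈ C,
      Tendsto (fun n : ℕ => μ.real (A ∩ T^[n] ⁻¹' B)) atTop (𝓝 (μ.real A * μ.real B))) :
    Ergodic T μ := by
  have hCm : ∀ A ∈ C, MeasurableSet A := fun A hA => by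
    rw [hgen]
    exact MeasurableSpace.measurableSet_generateFrom hA
  have hTn : ∀ n : ℕ, MeasurePreserving T^[n] μ μ := fun n => hT.iterate n
  have key : ∀ A ∈ C, ∀ B, MeasurableSet B →
      Tendsto (fun n : ℕ => μ.real (A ∩ T^[n] ⁻¹' B)) atTop (𝓝 (μ.real A * μ.real B)) := by
    intro A hA B hB
    have hAm := hCm A hA
    induction B, hB using MeasurableSpace.induction_on_inter hgen hC with
    | empty => simp
    | basic B hB => exact hmix A hA B hB
    | compl B hB ih =>
      have h1 : ∀ n : ℕ, μ.real (A ∩ T^[n] ⁻¹' Bᶜ) = μ.real A - μ.real (A ∩ T^[n] ⁻¹' B) := by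
        intro n
        have := measureReal_inter_add_sdiff (μ := μ) (s := A) ((hTn n).measurable hB)
        rw [preimage_compl, ← sdiff_eq]
        linarith
      simp only [h1, probReal_compl_eq_one_sub hB, mul_sub, mul_one]
      exact tendsto_const_nhds.sub ih
    | iUnion f hd hf ih =>
      have h1 : ∀ n : ℕ, μ.real (A ∩ T^[n] ⁻¹' ⋃ i, f i) =
          ∑' i, μ.real (A ∩ T^[n] ⁻¹' f i) := by
        intro n
        rw [preimage_iUnion, inter_iUnion, measureReal_def, measure_iUnion]
        · rw [ENNReal.tsum_toReal_eq (fun i => measure_ne_top _ _)]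
          rfl
        · exact fun i j hij => ((hd hij).preimage _).mono inter_subset_right inter_subset_right
        · exact fun i => hAm.inter ((hTn n).measurable (hf i))
      have hsum : HasSum (fun i => μ.real (f i)) (μ.real (⋃ i, f i)) := by
        rw [measureReal_def, measure_iUnion hd hf,
          ENNReal.tsum_toReal_eq (fun i => measure_ne_top _ _)]
        refine (ENNReal.summable_toReal ?_).hasSum
        rw [← measure_iUnion hd hf]
        exact measure_ne_top _ _
      simp only [h1, ← hsum.tsum_eq, ← tsum_mul_left]
      refine tendsto_tsum_of_dominated_convergence hsum.summable ih ?_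
      refine Eventually.of_forall fun n i => ?_
      rw [Real.norm_of_nonneg measureReal_nonneg,
        ← (hTn n).measureReal_preimage (hf i).nullMeasurableSet]
      exact measureReal_mono inter_subset_right
  refine ⟨hT, ⟨fun E hE hTE => ?_⟩⟩
  have hTnE : ∀ n : ℕ, T^[n] ⁻¹' E = E := fun n => by
    induction n with
    | zero => rfl
    | succ n ih => rw [Function.iterate_succ, preimage_comp, ih, hTE]
  -- For invariant E the mixing sequence is constant, so E is independent of `C`, hence of every
  -- measurable set and of itself.
  have h1 : ∀ A ∈ C, μ (A ∩ E) = μ A * μ E := fun A hA => by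
    have := tendsto_nhds_unique (key A hA E hE) (by simp only [hTnE]; exact tendsto_const_nhds)
    rw [← ENNReal.toReal_eq_toReal_iff' (measure_ne_top _ _) (by finiteness), ENNReal.toReal_mul]
    exact this.symm
  have h2 : μ.restrict E = μ E • μ := by
    refine ext_of_generate_finite C hgen hC (fun A hA => ?_) (by simp)
    rw [Measure.restrict_apply (hCm A hA), h1 A hA, Measure.smul_apply, smul_eq_mul, mul_comm]
  have h3 : μ E = μ E * μ E := by
    conv_lhs => rw [← Measure.restrict_apply_self, h2]
    rfl
  rw [eventuallyConst_set']
  rcases eq_or_ne (μ E) 0 with h0 | h0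
  · exact Or.inl (ae_eq_empty.2 h0)
  · right
    have h4 : μ E = 1 := by
      conv_lhs at h3 => rw [← mul_one (μ E)]
      exact ((ENNReal.mul_right_inj h0 (measure_ne_top _ _)).1 h3).symm
    exact ae_eq_univ.2 ((prob_compl_eq_zero_iff hE).2 h4)

section Bernoulli

theorem leftShift_iterate_preimage_pi {W : Type*} (n : ℕ) (s : Finset ℤ) (t : ℤ → Set W) :
    leftShift^[n] ⁻¹' (s : Set ℤ).pi t =
      ((s.image (· + (n : ℤ)) : Finset ℤ) : Set ℤ).pi fun i => t (i - n) := by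
  ext x
  simp only [mem_preimage, Set.mem_pi, leftShift_iterate, Finset.coe_image, forall_mem_image,
    add_sub_cancel_right]

variable {W : Type*} [MeasurableSpace W]

/-- The Bernoulli measure on bi-infinite sequences with marginal `P`. -/
noncomputable def bernoulli (P : Measure W) [IsProbabilityMeasure P] : Measure (ℤ → W) :=
  Measure.infinitePi fun _ => P

instance (P : Measure W) [IsProbabilityMeasure P] : IsProbabilityMeasure (bernoulli P) :=
  inferInstanceAs (IsProbabilityMeasure (Measure.infinitePi fun _ => P))

theorem bernoulli_pi (P : Measure W) [IsProbabilityMeasure P] (s : Finset ℤ) {t : ℤ → Set W}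
    (ht : ∀ i ∈ s, MeasurableSet (t i)) :
    bernoulli P ((s : Set ℤ).pi t) = ∏ i ∈ s, P (t i) :=
  Measure.infinitePi_pi _ ht

theorem measurePreserving_leftShift_bernoulli (P : Measure W) [IsProbabilityMeasure P] :
    MeasurePreserving leftShift (bernoulli P) (bernoulli P) := by
  refine ⟨measurable_leftShift, Measure.eq_infinitePi _ fun s t ht => ?_⟩
  rw [Measure.map_apply measurable_leftShift (.pi s.countable_toSet fun i _ => ht i)]
  have := leftShift_iterate_preimage_pi 1 s t
  rw [Function.iterate_one] at this
  rw [this, bernoulli_pi _ _ fun i _ => ht _, Finset.prod_image fun i _ j _ h => by simpa using h]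
  simp

theorem ergodic_leftShift_bernoulli (P : Measure W) [IsProbabilityMeasure P] :
    Ergodic leftShift (bernoulli P) := by
  refine ergodic_of_tendsto_piSystem (measurePreserving_leftShift_bernoulli P)
    generateFrom_squareCylinders.symm
    (isPiSystem_squareCylinders (fun _ => MeasurableSpace.isPiSystem_measurableSet)
      fun _ => MeasurableSet.univ) ?_
  rintro _ ⟨s, t, ht, rfl⟩ _ ⟨s', t', ht', rfl⟩
  simp only [mem_univ_pi, mem_ofPred_eq] at ht ht'
  refine tendsto_const_nhds.congr' ?_
  -- Once n exceeds all differences i - j with i ∈ s and j ∈ s', the two cylinders use disjoint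
  -- coordinates and are exactly independent.
  obtain ⟨C, hC⟩ := (s - s').bddAbove
  filter_upwards [eventually_gt_atTop C.toNat] with n hn
  have hdisj : Disjoint s (s'.image (· + (n : ℤ))) := by
    rw [Finset.disjoint_left]
    intro i hi hi'
    obtain ⟨j, hj, rfl⟩ := Finset.mem_image.1 hi'
    have := hC (Finset.mem_coe.2 (Finset.sub_mem_sub hi hj))
    omega
  rw [measureReal_def, measureReal_def, measureReal_def, ← ENNReal.toReal_mul]
  congr 1
  rw [leftShift_iterate_preimage_pi]
  classical
  have hunion : (s : Set ℤ).pi t ∩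
      ((s'.image (· + (n : ℤ)) : Finset ℤ) : Set ℤ).pi (fun i => t' (i - n)) =
      ((s ∪ s'.image (· + (n : ℤ)) : Finset ℤ) : Set ℤ).pi
        (fun i => if i ∈ s then t i else t' (i - n)) := by
    ext x
    simp only [mem_inter_iff, Set.mem_pi, Finset.mem_coe, Finset.mem_union]
    constructor
    · rintro ⟨h1, h2⟩ i hi
      split_ifs with h
      · exact h1 i h
      · exact h2 i (hi.resolve_left h)
    · intro h
      refine ⟨fun i hi => by simpa [hi] using h i (Or.inl hi), fun i hi => ?_⟩
      have := h i (Or.inr hi)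
      rwa [if_neg fun h' => (Finset.disjoint_left.1 hdisj h' hi)] at this
  rw [hunion, bernoulli_pi P s fun i _ => ht i, bernoulli_pi P s' fun i _ => ht' i,
    bernoulli_pi P (s ∪ _), Finset.prod_union hdisj]
  · congr 1
    · exact Finset.prod_congr rfl fun i hi => by rw [if_pos hi]
    · rw [Finset.prod_image fun i _ j _ h => by simpa using h]
      refine Finset.prod_congr rfl fun i hi => ?_
      rw [if_neg fun h' => Finset.disjoint_left.1 hdisj h' (Finset.mem_image_of_mem _ hi),
        add_sub_cancel_right]
  · intro i _
    split_ifs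
    exacts [ht i, ht' _]

end Bernoulli

/-! ### Concatenating independent blocks at random renewal times -/

/-- A renewal mark together with two sequences from which a block can be read. -/
abbrev Seed (L : Type*) : Type _ := I × ((ℤ → L) × (ℤ → L))

section Glue

variable {L : Type*}

/-- The sequence selected by a seed: the second one if the mark is below `q`. -/
noncomputable def pick (q : I) (w : Seed L) : ℤ → L := if w.1 < q then w.2.2 else w.2.1

/-- The time elapsed since the last renewal, a renewal being a mark below `p`. -/
noncomputable def age (p : I) (ω : ℤ → Seed L) (i : ℤ) : ℕ := sInf {k : ℕ | (ω (i - k)).1 < p}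

/-- At each renewal time, start reading the sequence selected by the seed from its origin. -/
noncomputable def glue (q p : I) (ω : ℤ → Seed L) : ℤ → L :=
  fun i => pick q (ω (i - age p ω i)) (age p ω i)

theorem age_eq {p : I} {ω : ℤ → Seed L} {i : ℤ} {k : ℕ} (h : (ω (i - k)).1 < p)
    (h' : ∀ l < k, p ≤ (ω (i - l)).1) : age p ω i = k := by
  refine le_antisymm (Nat.sInf_le h) (le_csInf ⟨k, h⟩ fun l hl => ?_)
  by_contra hlk
  exact absurd hl (not_lt.2 (h' l (not_le.1 hlk)))

theorem glue_semiconj (q p : I) :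
    Function.Semiconj (glue (L := L) q p) leftShift leftShift := by
  intro ω
  funext i
  have h : ∀ k : ℕ, leftShift ω (i - k) = ω (i + 1 - k) := fun k => by
    unfold leftShift
    congr 1
    ring
  have h' : age p (leftShift ω) i = age p ω (i + 1) := by simp only [age, h]
  change pick q (leftShift ω (i - age p (leftShift ω) i)) _ = _
  rw [h', h]
  rfl

/-- `A` is determined by the coordinates in `[-n, n]`. -/
def IsWindowSet (n : ℕ) (A : Set (ℤ → L)) : Prop :=
  ∀ x y : ℤ → L, (∀ i : ℤ, |i| ≤ n → x i = y i) → x ∈ A → y ∈ A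

/-- The last renewal before the window `[-n, n]` occurs at time `-n - k`, and there is no renewal
inside the window. -/
def lastRenewal (L : Type*) (p : I) (n k : ℕ) : Set (ℤ → Seed L) :=
  {ω | (ω (-n - k)).1 < p ∧ ∀ j ∈ Finset.Ioc (-n - k : ℤ) n, p ≤ (ω j).1}

/-- On this event the whole window lies in a single block. -/
theorem glue_mem_iff {q p : I} {n k : ℕ} {A : Set (ℤ → L)} (hA : IsWindowSet n A)
    {ω : ℤ → Seed L} (hω : ω ∈ lastRenewal L p n k) :
    glue q p ω ∈ A ↔ leftShift^[n + k] (pick q (ω (-n - k))) ∈ A := by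
  have key : ∀ i : ℤ, |i| ≤ n →
      glue q p ω i = leftShift^[n + k] (pick q (ω (-n - k))) i := by
    intro i hi
    rw [abs_le] at hi
    have h0 : ((i + n + k).toNat : ℤ) = i + n + k := Int.toNat_of_nonneg (by omega)
    have h1 : age p ω i = (i + n + k).toNat := by
      refine age_eq ?_ fun l hl => hω.2 _ ?_
      · rw [h0, show i - (i + n + k) = -n - k by ring]
        exact hω.1
      · rw [Finset.mem_Ioc]
        omega
    rw [leftShift_iterate]
    unfold glue
    rw [h1, h0, show i - (i + n + k) = -n - k by ring]
    congr 1
    push_cast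
    ring
  exact ⟨hA _ _ key, hA _ _ fun i hi => (key i hi).symm⟩

variable [MeasurableSpace L]

theorem measurable_pick (q : I) : Measurable (pick (L := L) q) :=
  Measurable.ite (measurable_fst measurableSet_Iio) (measurable_snd.comp measurable_snd)
    (measurable_fst.comp measurable_snd)

theorem measurableSet_mark {t : Set I} (ht : MeasurableSet t) :
    MeasurableSet {w : Seed L | w.1 ∈ t} :=
  measurable_fst ht

theorem measurableSet_mark_lt (p : I) (j : ℤ) :
    MeasurableSet {ω : ℤ → Seed L | (ω j).1 < p} :=
  (measurable_pi_apply j : Measurable fun ω : ℤ → Seed L => ω j)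
    (measurableSet_mark measurableSet_Iio)

theorem measurable_age (p : I) (i : ℤ) : Measurable fun ω : ℤ → Seed L => age p ω i :=
  measurable_sInf_nat fun k => measurableSet_mark_lt p (i - k)

theorem measurable_glue (q p : I) : Measurable (glue (L := L) q p) := by
  refine measurable_pi_lambda _ fun i => ?_
  have h1 : Measurable fun x : (ℤ → Seed L) × ℕ => pick q (x.1 (i - x.2)) x.2 :=
    measurable_from_prod_countable_left fun n =>
      (measurable_pi_apply (n : ℤ)).comp
        ((measurable_pick q).comp (measurable_pi_apply (i - (n : ℤ))))
  exact h1.comp (measurable_id.prodMk (measurable_age p i))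

variable (μ ν : Measure (ℤ → L)) [IsProbabilityMeasure μ] [IsProbabilityMeasure ν]

/-- The law of a seed. -/
noncomputable def seedLaw : Measure (Seed L) := (volume : Measure I).prod (μ.prod ν)

instance : IsProbabilityMeasure (seedLaw μ ν) :=
  inferInstanceAs (IsProbabilityMeasure ((volume : Measure I).prod (μ.prod ν)))

theorem seedLaw_mark (t : Set I) : seedLaw μ ν {w | w.1 ∈ t} = volume t := by
  have : {w : Seed L | w.1 ∈ t} = t ×ˢ univ := by ext; simp
  rw [this, seedLaw, Measure.prod_prod, measure_univ, mul_one]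

theorem seedLaw_pick {q p : I} (hqp : q ≤ p) {A : Set (ℤ → L)} (hA : MeasurableSet A) :
    seedLaw μ ν {w | w.1 < p ∧ pick q w ∈ A} =
      ENNReal.ofReal q * ν A + ENNReal.ofReal (p - q) * μ A := by
  have h : {w : Seed L | w.1 < p ∧ pick q w ∈ A} =
      (Iio q ×ˢ (univ ×ˢ A)) ∪ (Ico q p ×ˢ (A ×ˢ univ)) := by
    ext ⟨u, x, y⟩
    simp only [mem_ofPred_eq, pick, mem_union, mem_prod, mem_Iio, mem_Ico, mem_univ, true_and,
      and_true]
    by_cases hu : u < q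
    · simp [hu, hu.trans_le hqp]
    · simp [hu, not_lt.1 hu]
  rw [h, measure_union]
  · simp [seedLaw, Measure.prod_prod]
  · rw [Set.disjoint_left]
    rintro ⟨u, x, y⟩ h1 h2
    exact absurd h1.1 (not_lt.2 h2.1.1)
  · exact measurableSet_Ico.prod (hA.prod MeasurableSet.univ)

theorem ae_exists_renewal {p : I} (hp : 0 < p) :
    ∀ᵐ ω ∂bernoulli (seedLaw μ ν), ∀ i : ℤ, ∃ k : ℕ, (ω (i - k)).1 < p := by
  refine ae_all_iff.2 fun i => ?_
  change bernoulli (seedLaw μ ν) {ω | ¬∃ k : ℕ, (ω (i - k)).1 < p} = 0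
  have h1 : ∀ m : ℕ, bernoulli (seedLaw μ ν) {ω | ¬∃ k : ℕ, (ω (i - k)).1 < p} ≤
      ENNReal.ofReal (1 - p) ^ m := by
    intro m
    calc _ ≤ bernoulli (seedLaw μ ν)
          (((Finset.Ioc (i - m) i : Finset ℤ) : Set ℤ).pi fun _ => {w | w.1 ∈ Ici p}) := by
          refine measure_mono fun ω hω j hj => ?_
          simp only [mem_ofPred_eq, not_exists, not_lt] at hω
          have := hω (i - j).toNat
          rw [Finset.coe_Ioc, mem_Ioc] at hj
          rwa [Int.toNat_of_nonneg (by linarith), sub_sub_cancel] at this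
      _ = _ := by
          rw [bernoulli_pi _ _ fun _ _ => measurableSet_mark measurableSet_Ici]
          simp only [seedLaw_mark]
          simp
  refine le_antisymm (ge_of_tendsto' (ENNReal.tendsto_pow_atTop_nhds_zero_of_lt_one ?_) h1) bot_le
  have : (0 : ℝ) < p := hp
  rw [← ENNReal.ofReal_one]
  exact (ENNReal.ofReal_lt_ofReal_iff one_pos).2 (by linarith)

theorem measurableSet_lastRenewal (p : I) (n k : ℕ) :
    MeasurableSet (lastRenewal L p n k) := by
  have : lastRenewal L p n k = {ω | (ω (-n - k)).1 < p} ∩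
      ⋂ j ∈ Finset.Ioc (-n - k : ℤ) n, {ω | (ω j).1 < p}ᶜ := by
    ext
    simp [lastRenewal]
  rw [this]
  exact (measurableSet_mark_lt p _).inter <|
    Finset.measurableSet_biInter _ fun j _ => (measurableSet_mark_lt p j).compl

/-- Given the time of the last renewal, the block comes from ν with probability q / p and from μ
otherwise; invariance of μ and ν removes the offset n + k. The factor p on the left avoids a
division. -/
theorem bernoulli_lastRenewal_inter {q p : I} (hqp : q ≤ p)
    (hμ : MeasurePreserving leftShift μ μ) (hν : MeasurePreserving leftShift ν ν) {n : ℕ}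
    {A : Set (ℤ → L)} (hA : IsWindowSet n A) (hAm : MeasurableSet A) (k : ℕ) :
    ENNReal.ofReal p * bernoulli (seedLaw μ ν) (lastRenewal L p n k ∩ glue q p ⁻¹' A) =
      (ENNReal.ofReal q * ν A + ENNReal.ofReal (p - q) * μ A) *
        bernoulli (seedLaw μ ν) (lastRenewal L p n k) := by
  have box : ∀ B : Set (Seed L), MeasurableSet B →
      bernoulli (seedLaw μ ν)
        {ω | ω (-n - k) ∈ B ∧ ∀ j ∈ Finset.Ioc (-n - k : ℤ) n, p ≤ (ω j).1} =
      seedLaw μ ν B * ∏ j ∈ Finset.Ioc (-n - k : ℤ) n, seedLaw μ ν {w | w.1 ∈ Ici p} := by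
    intro B hB
    classical
    have e : {ω : ℤ → Seed L | ω (-n - k) ∈ B ∧
        ∀ j ∈ Finset.Ioc (-n - k : ℤ) n, p ≤ (ω j).1} =
        ((insert (-n - k : ℤ) (Finset.Ioc (-n - k : ℤ) n) : Finset ℤ) : Set ℤ).pi
          fun j => if j = -n - k then B else {w | w.1 ∈ Ici p} := by
      ext ω
      rw [Finset.coe_insert, Set.insert_pi]
      simp only [mem_ofPred_eq, mem_inter_iff, mem_preimage, Function.eval, if_true]
      refine and_congr Iff.rfl (forall₂_congr fun j hj => ?_)
      simp only [(Finset.mem_Ioc.1 hj).1.ne', if_false]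
      rfl
    rw [e, bernoulli_pi, Finset.prod_insert (by simp), if_pos rfl]
    · congr 1
      exact Finset.prod_congr rfl fun j hj => by rw [if_neg (Finset.mem_Ioc.1 hj).1.ne']
    · intro j _
      split_ifs
      exacts [hB, measurableSet_mark measurableSet_Ici]
  have hAm' : MeasurableSet (leftShift^[n + k] ⁻¹' A) := (hμ.iterate (n + k)).measurable hAm
  have h1 : lastRenewal L p n k ∩ glue q p ⁻¹' A =
      {ω | ω (-n - k) ∈ {w : Seed L | w.1 < p ∧ pick q w ∈ leftShift^[n + k] ⁻¹' A} ∧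
        ∀ j ∈ Finset.Ioc (-n - k : ℤ) n, p ≤ (ω j).1} := by
    ext ω
    constructor
    · rintro ⟨h, h'⟩
      exact ⟨⟨h.1, (glue_mem_iff hA h).1 h'⟩, h.2⟩
    · rintro ⟨h, h'⟩
      exact ⟨⟨h.1, h'⟩, (glue_mem_iff hA ⟨h.1, h'⟩).2 h.2⟩
  have h2 : lastRenewal L p n k = {ω | ω (-n - k) ∈ {w : Seed L | w.1 ∈ Iio p} ∧
        ∀ j ∈ Finset.Ioc (-n - k : ℤ) n, p ≤ (ω j).1} := rfl
  have hB : MeasurableSet {w : Seed L | w.1 < p ∧ pick q w ∈ leftShift^[n + k] ⁻¹' A} :=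
    (measurableSet_mark measurableSet_Iio).inter ((measurable_pick q) hAm')
  rw [h1, box _ hB, h2,
    box _ (measurableSet_mark measurableSet_Iio), seedLaw_pick μ ν hqp hAm',
    seedLaw_mark _ _ (Iio p), unitInterval.volume_Iio, (hμ.iterate _).measure_preimage hAm.nullMeasurableSet,
    (hν.iterate _).measure_preimage hAm.nullMeasurableSet]
  ring

/-- Almost surely there is a renewal at or before -n, so the event fails only through a renewal at
one of the 2n sites of (-n, n]. A renewal at -n itself is harmless, which makes the bound 0 for n =
0. -/
theorem bernoulli_compl_lastRenewal_le {p : I} (hp : 0 < p) (n : ℕ) :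
    bernoulli (seedLaw μ ν) (⋃ k, lastRenewal L p n k)ᶜ ≤ 2 * n * ENNReal.ofReal p := by
  have hsub : (⋃ k, lastRenewal L p n k)ᶜ ⊆
      (⋃ j ∈ Finset.Ioc (-n : ℤ) n, {ω | (ω j).1 < p}) ∪
        {ω | ¬∀ i : ℤ, ∃ k : ℕ, (ω (i - k)).1 < p} := by
    classical
    intro ω hω
    by_contra h
    simp only [mem_union, mem_iUnion, mem_ofPred_eq, not_or, not_exists, not_lt, not_not] at h
    obtain ⟨h1, h2⟩ := h
    refine hω (mem_iUnion.2 ⟨Nat.find (h2 (-n)), Nat.find_spec (h2 (-n)), fun j hj => ?_⟩)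
    rw [Finset.mem_Ioc] at hj
    rcases lt_or_ge (-n : ℤ) j with hj' | hj'
    · exact h1 j (Finset.mem_Ioc.2 ⟨hj', hj.2⟩)
    · have h3 := Nat.find_min (h2 (-n)) (m := (-n - j).toNat) (by omega)
      rw [Int.toNat_of_nonneg (by linarith), sub_sub_cancel] at h3
      exact not_lt.1 h3
  have hnull : bernoulli (seedLaw μ ν) {ω | ¬∀ i : ℤ, ∃ k : ℕ, (ω (i - k)).1 < p} = 0 :=
    ae_exists_renewal μ ν hp
  have hone : ∀ j : ℤ, bernoulli (seedLaw μ ν) {ω | (ω j).1 < p} = ENNReal.ofReal p := by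
    intro j
    have := bernoulli_pi (seedLaw μ ν) {j} (t := fun _ => {w | w.1 ∈ Iio p})
      fun _ _ => measurableSet_mark measurableSet_Iio
    rw [Finset.prod_singleton, seedLaw_mark, unitInterval.volume_Iio] at this
    rw [← this]
    congr 1
    ext ω
    simp
  calc _ ≤ _ := measure_mono hsub
    _ ≤ _ := measure_union_le _ _
    _ ≤ ∑ j ∈ Finset.Ioc (-n : ℤ) n, bernoulli (seedLaw μ ν) {ω | (ω j).1 < p} + 0 := by
        rw [hnull]
        gcongr
        exact measure_biUnion_finset_le _ _
    _ = _ := by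
        simp only [hone, Finset.sum_const, Int.card_Ioc, add_zero, nsmul_eq_mul]
        congr 1
        rw [show ((n : ℤ) - -n).toNat = 2 * n by omega]
        push_cast
        rfl

/-- The law of the sequence obtained by concatenation. -/
noncomputable def glueLaw (q p : I) : Measure (ℤ → L) :=
  (bernoulli (seedLaw μ ν)).map (glue q p)

instance (q p : I) : IsProbabilityMeasure (glueLaw μ ν q p) :=
  Measure.isProbabilityMeasure_map (measurable_glue q p).aemeasurable

/-- The law of the sequence obtained by concatenation, as a probability measure. -/
noncomputable def glueProb (q p : I) : ProbabilityMeasure (ℤ → L) :=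
  ⟨glueLaw μ ν q p, inferInstance⟩

theorem ergodic_glueLaw (q p : I) : Ergodic leftShift (glueLaw μ ν q p) :=
  ((measurable_glue q p).measurePreserving _).ergodic_of_ergodic_semiconj
    (ergodic_leftShift_bernoulli _) measurable_leftShift (glue_semiconj q p)

/-- Conditionally on `E` the probability of `A` is exactly the convex combination, so the error is
at most the probability of the complement of `E`. -/
theorem abs_glueLaw_sub_le (hμ : MeasurePreserving leftShift μ μ)
    (hν : MeasurePreserving leftShift ν ν) {p : I} (hp : 0 < p) (s : I) {n : ℕ}
    {A : Set (ℤ → L)} (hA : IsWindowSet n A) (hAm : MeasurableSet A) :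
    |(glueLaw μ ν (p * s) p).real A - (s * ν.real A + (1 - s) * μ.real A)| ≤ 2 * n * p := by
  set q : I := p * s with hq
  have hqp : q ≤ p := by
    have h1 : (p : ℝ) * s ≤ p := mul_le_of_le_one_right p.2.1 s.2.2
    exact h1
  set B := bernoulli (seedLaw μ ν)
  set E := ⋃ k, lastRenewal L p n k
  have hEm : MeasurableSet E := MeasurableSet.iUnion fun k => measurableSet_lastRenewal p n k
  have hdisj : Pairwise (Function.onFun Disjoint (lastRenewal L p n)) := by
    have : ∀ k l, k < l → Disjoint (lastRenewal L p n k) (lastRenewal L p n l) := by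
      intro k l hkl
      rw [Set.disjoint_left]
      intro ω h1 h2
      refine absurd h1.1 (not_lt.2 (h2.2 _ ?_))
      rw [Finset.mem_Ioc]
      omega
    intro k l hkl
    rcases lt_or_gt_of_ne hkl with h | h
    exacts [this k l h, (this l k h).symm]
  have hGm : MeasurableSet (glue q p ⁻¹' A) := measurable_glue q p hAm
  have h1 : ENNReal.ofReal p * B (E ∩ glue q p ⁻¹' A) =
      (ENNReal.ofReal q * ν A + ENNReal.ofReal (p - q) * μ A) * B E := by
    rw [iUnion_inter, measure_iUnion, measure_iUnion hdisj, ← ENNReal.tsum_mul_left,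
      ← ENNReal.tsum_mul_left]
    · exact tsum_congr fun k => bernoulli_lastRenewal_inter μ ν hqp hμ hν hA hAm k
    · exact fun k => measurableSet_lastRenewal p n k
    · exact fun k l hkl => (hdisj hkl).mono inter_subset_left inter_subset_left
    · exact fun k => (measurableSet_lastRenewal p n k).inter hGm
  have hp' : (0 : ℝ) < p := hp
  have hqp' : (q : ℝ) ≤ p := hqp
  have h2 : (p : ℝ) * B.real (E ∩ glue q p ⁻¹' A) =
      (q * ν.real A + (p - q) * μ.real A) * B.real E := by
    have := congrArg ENNReal.toReal h1
    rw [ENNReal.toReal_mul, ENNReal.toReal_mul, ENNReal.toReal_add (by finiteness) (by finiteness),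
      ENNReal.toReal_mul, ENNReal.toReal_mul, ENNReal.toReal_ofReal p.2.1,
      ENNReal.toReal_ofReal q.2.1, ENNReal.toReal_ofReal (by linarith)] at this
    exact this
  have h3 : B.real Eᶜ ≤ 2 * n * p := by
    have := ENNReal.toReal_mono (by finiteness) (bernoulli_compl_lastRenewal_le μ ν hp n)
    rw [ENNReal.toReal_mul, ENNReal.toReal_ofReal p.2.1] at this
    rw [measureReal_def]
    refine this.trans_eq ?_
    simp
  have h4 : B.real E = 1 - B.real Eᶜ := by rw [probReal_compl_eq_one_sub hEm]; ring
  have h5 := measureReal_inter_add_sdiff (μ := B) (s := glue q p ⁻¹' A) hEm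
  have h6 : B.real (glue q p ⁻¹' A \ E) ≤ B.real Eᶜ := measureReal_mono fun x hx => hx.2
  have h7 : (glueLaw μ ν q p).real A = B.real (glue q p ⁻¹' A) :=
    map_measureReal_apply (measurable_glue q p) hAm
  have hq' : (q : ℝ) = p * s := rfl
  set lam := (s : ℝ) * ν.real A + (1 - s) * μ.real A with hlam
  have h8 : B.real (E ∩ glue q p ⁻¹' A) = lam * B.real E := by
    have : (p : ℝ) * B.real (E ∩ glue q p ⁻¹' A) = p * (lam * B.real E) := by
      rw [h2, hq', hlam]
      ring
    exact mul_left_cancel₀ hp'.ne' this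
  have hs0 : (0 : ℝ) ≤ s := s.2.1
  have hs1 : (0 : ℝ) ≤ 1 - s := by linarith [s.2.2]
  have hν0 : 0 ≤ ν.real A := measureReal_nonneg
  have hμ0 : 0 ≤ μ.real A := measureReal_nonneg
  have hν1 : ν.real A ≤ 1 := measureReal_le_one
  have hμ1 : μ.real A ≤ 1 := measureReal_le_one
  have hl0 : 0 ≤ lam := by positivity
  have hl1 : lam ≤ 1 := by
    have := mul_le_mul_of_nonneg_left hν1 hs0
    have := mul_le_mul_of_nonneg_left hμ1 hs1
    linarith
  have hc0 : 0 ≤ B.real Eᶜ := measureReal_nonneg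
  have hd0 : 0 ≤ B.real (glue q p ⁻¹' A \ E) := measureReal_nonneg
  rw [h7, ← h5, inter_comm, h8, h4, abs_le]
  constructor <;> nlinarith [mul_nonneg hl0 hc0, mul_nonneg (sub_nonneg.2 hl1) hc0]

end Glue

/-! ### Dependence of the glued law on its two thresholds. -/

section Continuity

variable {L : Type*} [TopologicalSpace L]

/-- Each coordinate consults finitely many marks, and their comparisons with the thresholds survive
small perturbations when no mark equals a threshold. -/
theorem continuousAt_glue {q₀ p₀ : I} {ω : ℤ → Seed L} (h : ∀ i : ℤ, ∃ k : ℕ, (ω (i - k)).1 < p₀)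
    (hq : ∀ j, (ω j).1 ≠ q₀) (hp : ∀ j, (ω j).1 ≠ p₀) :
    ContinuousAt (fun r : I × I => glue r.1 r.2 ω) (q₀, p₀) := by
  classical
  rw [continuousAt_pi]
  intro i
  refine ContinuousAt.congr (f := fun _ => glue q₀ p₀ ω i) continuousAt_const ?_
  have hlt : ∀ j, ∀ᶠ r in 𝓝 ((q₀, p₀) : I × I), ((ω j).1 < r.2 ↔ (ω j).1 < p₀) ∧
      ((ω j).1 < r.1 ↔ (ω j).1 < q₀) := by
    have hev : ∀ u c : I, u ≠ c → ∀ᶠ d in 𝓝 c, (u < d ↔ u < c) := by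
      intro u c huc
      rcases lt_or_gt_of_ne huc with h | h
      · filter_upwards [lt_mem_nhds h] with d hd
        simp [h, hd]
      · filter_upwards [gt_mem_nhds h] with d hd
        simp [h.le, not_lt.2, hd.le]
    intro j
    exact (continuous_snd.continuousAt.eventually (hev _ _ (hp j))).and
      (continuous_fst.continuousAt.eventually (hev _ _ (hq j)))
  obtain ⟨k, hk, hk'⟩ : ∃ k : ℕ, (ω (i - k)).1 < p₀ ∧ ∀ l < k, p₀ ≤ (ω (i - l)).1 :=
    ⟨Nat.find (h i), Nat.find_spec (h i), fun l hl => not_lt.1 (Nat.find_min (h i) hl)⟩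
  have hev : ∀ᶠ r in 𝓝 ((q₀, p₀) : I × I), ∀ l ∈ Finset.range (k + 1),
      ((ω (i - (l : ℕ))).1 < r.2 ↔ (ω (i - (l : ℕ))).1 < p₀) ∧
      ((ω (i - (l : ℕ))).1 < r.1 ↔ (ω (i - (l : ℕ))).1 < q₀) :=
    (Finset.eventually_all _).2 fun l _ => hlt _
  filter_upwards [hev] with r hr
  have h1 : age p₀ ω i = k := age_eq hk hk'
  have h2 : age r.2 ω i = k := age_eq ((hr k (by simp)).1.2 hk) fun l hl =>
    not_lt.1 fun h' => absurd ((hr l (Finset.mem_range.2 (by omega))).1.1 h') (not_lt.2 (hk' l hl))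
  unfold glue pick
  rw [h1, h2]
  simp only [(hr k (by simp)).2]

variable [MeasurableSpace L] [SecondCountableTopology L] [BorelSpace L]
  (μ ν : Measure (ℤ → L)) [IsProbabilityMeasure μ] [IsProbabilityMeasure ν]

theorem continuousAt_glueProb (q₀ : I) {p₀ : I} (hp₀ : 0 < p₀) :
    ContinuousAt (fun r : I × I => glueProb μ ν r.1 r.2) (q₀, p₀) := by
  refine ProbabilityMeasure.tendsto_iff_forall_integral_tendsto.2 fun f => ?_
  have hmap : ∀ r : I × I, ∫ x, f x ∂(glueProb μ ν r.1 r.2 : Measure (ℤ → L)) =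
      ∫ ω, f (glue r.1 r.2 ω) ∂bernoulli (seedLaw μ ν) := fun r =>
    integral_map (measurable_glue r.1 r.2).aemeasurable
      f.continuous.measurable.aestronglyMeasurable
  rw [hmap (q₀, p₀)]
  simp only [hmap]
  have hne : ∀ c : I, ∀ᵐ ω ∂bernoulli (seedLaw μ ν), ∀ j : ℤ, (ω j).1 ≠ c := by
    intro c
    refine ae_all_iff.2 fun j => ?_
    have := bernoulli_pi (seedLaw μ ν) {j} (t := fun _ => {w | w.1 ∈ ({c} : Set I)})
      fun _ _ => measurableSet_mark (measurableSet_singleton c)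
    rw [Finset.prod_singleton, seedLaw_mark, measure_singleton] at this
    rw [ae_iff, ← this]
    congr 1
    ext ω
    simp
  refine tendsto_integral_filter_of_dominated_convergence (fun _ => ‖f‖) ?_ ?_
    (integrable_const _) ?_
  · exact Eventually.of_forall fun r =>
      (f.continuous.measurable.comp (measurable_glue r.1 r.2)).aestronglyMeasurable
  · exact Eventually.of_forall fun r => ae_of_all _ fun ω => f.norm_coe_le_norm _
  · filter_upwards [ae_exists_renewal μ ν hp₀, hne q₀, hne p₀] with ω h1 h2 h3
    exact (f.continuous.tendsto _).comp (continuousAt_glue h1 h2 h3)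

end Continuity

/-! ### Weak convergence on sequence spaces -/

section Window

variable {L : Type*}

theorem IsWindowSet.mono {n m : ℕ} (h : n ≤ m) {A : Set (ℤ → L)} (hA : IsWindowSet n A) :
    IsWindowSet m A :=
  fun x y hxy => hA x y fun i hi => hxy i (hi.trans (by exact_mod_cast h))

theorem IsWindowSet.inter {n : ℕ} {A B : Set (ℤ → L)} (hA : IsWindowSet n A)
    (hB : IsWindowSet n B) : IsWindowSet n (A ∩ B) :=
  fun x y hxy h => ⟨hA x y hxy h.1, hB x y hxy h.2⟩

theorem IsWindowSet.compl {n : ℕ} {A : Set (ℤ → L)} (hA : IsWindowSet n A) :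
    IsWindowSet n Aᶜ :=
  fun x y hxy h h' => h (hA y x (fun i hi => (hxy i hi).symm) h')

variable [TopologicalSpace L]

theorem IsWindowSet.isOpen [DiscreteTopology L] {n : ℕ} {A : Set (ℤ → L)} (hA : IsWindowSet n A) :
    IsOpen A := by
  rw [isOpen_pi_iff]
  intro x hx
  refine ⟨Finset.Icc (-n) n, fun i => {x i}, fun i _ => ⟨isOpen_discrete _, rfl⟩, fun y hy => ?_⟩
  refine hA x y (fun i hi => ?_) hx
  exact (hy i (by simpa [← abs_le] using hi)).symm

theorem IsWindowSet.isClopen [DiscreteTopology L] {n : ℕ} {A : Set (ℤ → L)} (hA : IsWindowSet n A) :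
    IsClopen A :=
  ⟨⟨hA.compl.isOpen⟩, hA.isOpen⟩

theorem exists_isWindowSet {O : Set (ℤ → L)} (hO : IsOpen O) {x : ℤ → L} (hx : x ∈ O) :
    ∃ n A, IsWindowSet n A ∧ x ∈ A ∧ A ⊆ O := by
  obtain ⟨J, u, hu, hJ⟩ := isOpen_pi_iff.1 hO x hx
  refine ⟨J.sup Int.natAbs, {y | ∀ i : ℤ, |i| ≤ J.sup Int.natAbs → y i = x i}, ?_, ?_, ?_⟩
  · intro y z hyz hy i hi
    rw [← hyz i hi, hy i hi]
  · exact fun i _ => rfl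
  · intro y hy
    refine hJ fun i hi => ?_
    rw [hy i]
    · exact (hu i hi).2
    · rw [Int.abs_eq_natAbs]
      exact_mod_cast Finset.le_sup (f := Int.natAbs) hi

/-- Weak convergence may be tested on sets that depend on finitely many coordinates. -/
theorem tendsto_of_isWindowSet [DiscreteTopology L] {X : Type*} [TopologicalSpace X]
    [MeasurableSpace X]
    [OpensMeasurableSpace X] [SecondCountableTopology X] {e : X → ℤ → L} (he : IsInducing e)
    {ι : Type*} {l : Filter ι} [l.IsCountablyGenerated] {μs : ι → ProbabilityMeasure X}
    {μ : ProbabilityMeasure X}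
    (h : ∀ n A, IsWindowSet n A → Tendsto (fun a => (μs a : Measure X).real (e ⁻¹' A)) l
      (𝓝 ((μ : Measure X).real (e ⁻¹' A)))) :
    Tendsto μs l (𝓝 μ) := by
  have hpi : IsPiSystem {s : Set X | ∃ n A, IsWindowSet n A ∧ e ⁻¹' A = s} := by
    rintro _ ⟨n, A, hA, rfl⟩ _ ⟨m, B, hB, rfl⟩ _
    exact ⟨max n m, A ∩ B, (hA.mono (le_max_left _ _)).inter (hB.mono (le_max_right _ _)), rfl⟩
  refine hpi.tendsto_probabilityMeasure_of_tendsto_of_mem ?_ ?_ ?_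
  · rintro _ ⟨n, A, hA, rfl⟩
    exact (hA.isOpen.preimage he.continuous).measurableSet
  · intro u hu x hx
    obtain ⟨O, hO, rfl⟩ := he.isOpen_iff.1 hu
    obtain ⟨n, A, hA, hxA, hAO⟩ := exists_isWindowSet hO hx
    exact ⟨_, ⟨n, A, hA, rfl⟩, (hA.isOpen.preimage he.continuous).mem_nhds hxA,
      preimage_mono hAO⟩
  · rintro _ ⟨n, A, hA, rfl⟩
    rw [← NNReal.tendsto_coe]
    exact h n A hA

end Window

theorem IsWindowSet.measurableSet {n : ℕ} {A : Set (ℤ → Letter M N)} (hA : IsWindowSet n A) :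
    MeasurableSet A := hA.isOpen.measurableSet

/-- The image on the Dyck-Motzkin shift of a probability measure on the full shift. -/
noncomputable def rematchProb (κ : ProbabilityMeasure (ℤ → Letter M N)) :
    ProbabilityMeasure (dyckMotzkinShift M N) :=
  κ.map measurable_rematch.aemeasurable

/-- The preimage of a clopen window set has its frontier among the discontinuities of `rematch`, and
only the limit measure has to ignore these. -/
theorem tendsto_rematchProb {ι : Type*} {l : Filter ι} [l.IsCountablyGenerated]
    {κs : ι → ProbabilityMeasure (ℤ → Letter M N)} {κ : ProbabilityMeasure (ℤ → Letter M N)}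
    (h : Tendsto κs l (𝓝 κ)) (hκ : ∀ᵐ x ∂(κ : Measure (ℤ → Letter M N)), RightMatched x) :
    Tendsto (fun a => rematchProb (κs a)) l (𝓝 (rematchProb κ)) := by
  refine tendsto_of_isWindowSet IsInducing.subtypeVal fun n A hA => ?_
  have hC : IsClopen ((↑) ⁻¹' A : Set (dyckMotzkinShift M N)) :=
    hA.isClopen.preimage continuous_subtype_val
  have hmap : ∀ κ : ProbabilityMeasure (ℤ → Letter M N),
      (rematchProb κ : Measure (dyckMotzkinShift M N)).real ((↑) ⁻¹' A) =
        (κ : Measure (ℤ → Letter M N)).real (rematch ⁻¹' ((↑) ⁻¹' A)) := fun κ => by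
    rw [rematchProb, ProbabilityMeasure.toMeasure_map]
    exact map_measureReal_apply measurable_rematch hC.isOpen.measurableSet
  simp only [hmap]
  have hnull : (κ : Measure (ℤ → Letter M N)) (frontier (rematch ⁻¹' ((↑) ⁻¹' A))) = 0 := by
    refine measure_mono_null (fun x hx => ?_) (ae_iff.1 hκ)
    intro hm
    have hc : ContinuousAt rematch x := RightMatched.continuousAt_rematch hm
    by_cases hxA : rematch x ∈ ((↑) ⁻¹' A : Set (dyckMotzkinShift M N))
    · exact hx.2 (mem_interior_iff_mem_nhds.2 (hc (hC.isOpen.mem_nhds hxA)))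
    · have h1 : rematch ⁻¹' ((↑) ⁻¹' A : Set (dyckMotzkinShift M N))ᶜ ∈ 𝓝 x :=
        hc (hC.compl.isOpen.mem_nhds hxA)
      obtain ⟨y, hy, hy'⟩ := mem_closure_iff_nhds.1 hx.1 _ h1
      exact hy hy'
  exact (ENNReal.tendsto_toReal (measure_ne_top _ _)).comp
    (ProbabilityMeasure.tendsto_measure_of_null_frontier_of_tendsto' h hnull)

/-! ### Drift -/

/-- The mean height increment. -/
noncomputable def drift (κ : Measure (ℤ → Letter M N)) : ℝ := ∫ x, ((x 0).sgn : ℝ) ∂κ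

theorem isWindowSet_sgn (c : ℤ) : IsWindowSet 0 {x : ℤ → Letter M N | (x 0).sgn = c} := by
  intro x y hxy hx
  rwa [mem_ofPred_eq, ← hxy 0 (by simp)]

theorem drift_eq (κ : Measure (ℤ → Letter M N)) [IsProbabilityMeasure κ] :
    drift κ = κ.real {x | (x 0).sgn = 1} - κ.real {x | (x 0).sgn = -1} := by
  have h1 := (isWindowSet_sgn (M := M) (N := N) 1).measurableSet
  have h2 := (isWindowSet_sgn (M := M) (N := N) (-1)).measurableSet
  have h3 : ∀ x : ℤ → Letter M N, ((x 0).sgn : ℝ) =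
      {x : ℤ → Letter M N | (x 0).sgn = 1}.indicator (fun _ => (1 : ℝ)) x -
        {x : ℤ → Letter M N | (x 0).sgn = -1}.indicator (fun _ => (1 : ℝ)) x := by
    intro x
    cases hx : x 0 <;> simp [indicator, hx, Letter.sgn]
  unfold drift
  simp only [h3]
  rw [integral_sub ((integrable_const _).indicator h1) ((integrable_const _).indicator h2),
    integral_indicator h1, integral_indicator h2]
  simp

/-! ### A path between two invariant measures of the full shift -/

/-- The renewal rate along the path. -/
def rate (ε s : I) : I := ε * (s * σ s)

theorem rate_pos {ε s : I} (hε : 0 < ε) (h0 : s ≠ 0) (h1 : s ≠ 1) : 0 < rate ε s := by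
  have h2 : (0 : ℝ) < ε := hε
  have h3 : (0 : ℝ) < s := unitInterval.pos_iff_ne_zero.2 h0
  have h4 : (s : ℝ) < 1 := unitInterval.lt_one_iff_ne_one.2 h1
  have : (0 : ℝ) < ε * (s * (1 - s)) := mul_pos h2 (mul_pos h3 (by linarith))
  exact this

theorem rate_le (ε s : I) : (rate ε s : ℝ) ≤ ε :=
  mul_le_of_le_one_right ε.2.1 (s * σ s).2.2

theorem continuous_rate (ε : I) : Continuous (rate ε) := by
  unfold rate
  fun_prop

section Interpolate

variable (μ ν : ProbabilityMeasure (ℤ → Letter M N))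

open Classical in
/-- A path from `μ` to `ν` that consists of concatenations of long blocks. -/
noncomputable def interpolate (ε s : I) : ProbabilityMeasure (ℤ → Letter M N) :=
  if s = 0 then μ else if s = 1 then ν else
    glueProb (μ : Measure (ℤ → Letter M N)) ν (rate ε s * s) (rate ε s)

@[simp] theorem interpolate_zero (ε : I) : interpolate μ ν ε 0 = μ := by simp [interpolate]

@[simp] theorem interpolate_one (ε : I) : interpolate μ ν ε 1 = ν := by simp [interpolate]

variable {μ ν}

theorem ergodic_interpolate (hμ : Ergodic leftShift (μ : Measure (ℤ → Letter M N)))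
    (hν : Ergodic leftShift (ν : Measure (ℤ → Letter M N))) (ε s : I) :
    Ergodic leftShift (interpolate μ ν ε s : Measure (ℤ → Letter M N)) := by
  unfold interpolate
  split_ifs
  exacts [hμ, hν, ergodic_glueLaw _ _ _ _]

theorem abs_interpolate_sub_le
    (hμ : MeasurePreserving leftShift (μ : Measure (ℤ → Letter M N)) μ)
    (hν : MeasurePreserving leftShift (ν : Measure (ℤ → Letter M N)) ν)
    {ε : I} (hε : 0 < ε) (s : I) {n : ℕ}
    {A : Set (ℤ → Letter M N)} (hA : IsWindowSet n A) :
    |(interpolate μ ν ε s : Measure (ℤ → Letter M N)).real A -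
      (s * (ν : Measure (ℤ → Letter M N)).real A +
        (1 - s) * (μ : Measure (ℤ → Letter M N)).real A)| ≤ 2 * n * rate ε s := by
  have hr : (0 : ℝ) ≤ rate ε s := (rate ε s).2.1
  by_cases h0 : s = 0
  · subst h0
    simpa using by positivity
  by_cases h1 : s = 1
  · subst h1
    simpa using by positivity
  rw [interpolate, if_neg h0, if_neg h1]
  exact abs_glueLaw_sub_le _ _ hμ hν (rate_pos hε h0 h1) s hA hA.measurableSet

/-- The increment is read in the window n = 0, where the approximation error is zero; hence an exact
equality. -/
theorem drift_interpolate
    (hμ : MeasurePreserving leftShift (μ : Measure (ℤ → Letter M N)) μ)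
    (hν : MeasurePreserving leftShift (ν : Measure (ℤ → Letter M N)) ν)
    {ε : I} (hε : 0 < ε) (s : I) :
    drift (interpolate μ ν ε s : Measure (ℤ → Letter M N)) =
      s * drift (ν : Measure (ℤ → Letter M N)) +
        (1 - s) * drift (μ : Measure (ℤ → Letter M N)) := by
  have key : ∀ c : ℤ, (interpolate μ ν ε s : Measure (ℤ → Letter M N)).real {x | (x 0).sgn = c} =
      (s * (ν : Measure (ℤ → Letter M N)).real {x | (x 0).sgn = c} +
        (1 - s) * (μ : Measure (ℤ → Letter M N)).real {x | (x 0).sgn = c}) := fun c => by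
    have := abs_interpolate_sub_le hμ hν hε s (isWindowSet_sgn (M := M) (N := N) c)
    simpa [sub_eq_zero] using this
  rw [drift_eq, drift_eq, drift_eq, key, key]
  ring

/-- Inside (0, 1) the rate is positive and `continuousAt_glueProb` applies. At the endpoints the
rate tends to 0, and the approximation bound squeezes instead. -/
theorem continuous_interpolate
    (hμ : MeasurePreserving leftShift (μ : Measure (ℤ → Letter M N)) μ)
    (hν : MeasurePreserving leftShift (ν : Measure (ℤ → Letter M N)) ν)
    {ε : I} (hε : 0 < ε) : Continuous (interpolate μ ν ε) := by
  refine continuous_iff_continuousAt.2 fun s₀ => ?_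
  by_cases h : s₀ = 0 ∨ s₀ = 1
  · refine tendsto_of_isWindowSet IsInducing.id fun n A hA => ?_
    have h0 : rate ε s₀ = 0 := by rcases h with rfl | rfl <;> simp [rate]
    have h1 := abs_interpolate_sub_le hμ hν hε s₀ hA
    rw [h0] at h1
    have h2 : (interpolate μ ν ε s₀ : Measure (ℤ → Letter M N)).real A = _ :=
      sub_eq_zero.1 (abs_nonpos_iff.1 (h1.trans_eq (by simp)))
    simp only [preimage_id_eq, id]
    rw [h2]
    have h3 : Tendsto (fun s : I => (s : ℝ) * (ν : Measure (ℤ → Letter M N)).real A +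
        (1 - s) * (μ : Measure (ℤ → Letter M N)).real A) (𝓝 s₀) (𝓝 _) :=
      Continuous.tendsto (by fun_prop) s₀
    have h4 : Tendsto (fun s : I => 2 * n * (rate ε s : ℝ)) (𝓝 s₀) (𝓝 0) := by
      have := Continuous.tendsto (f := fun s : I => 2 * n * (rate ε s : ℝ))
        (continuous_const.mul (continuous_subtype_val.comp (continuous_rate ε))) s₀
      simpa [h0] using this
    have h5 := squeeze_zero_norm (f := fun s => (interpolate μ ν ε s : Measure _).real A -
      (s * (ν : Measure (ℤ → Letter M N)).real A +
        (1 - s) * (μ : Measure (ℤ → Letter M N)).real A))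
      (fun s => abs_interpolate_sub_le hμ hν hε s hA) h4
    simpa using h5.add h3
  · push Not at h
    have hc : ContinuousAt (fun s : I => glueProb (μ : Measure (ℤ → Letter M N)) ν
        (rate ε s * s) (rate ε s)) s₀ :=
      ContinuousAt.comp (f := fun s : I => (rate ε s * s, rate ε s))
        (continuousAt_glueProb (μ : Measure (ℤ → Letter M N)) ν _ (rate_pos hε h.1 h.2))
        (((continuous_rate ε).mul continuous_id).prodMk (continuous_rate ε)).continuousAt
    refine hc.congr ?_
    filter_upwards [isOpen_ne.mem_nhds h.1, isOpen_ne.mem_nhds h.2] with s hs0 hs1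
    rw [interpolate, if_neg hs0, if_neg hs1]

end Interpolate

/-! ### Paths of ergodic measures -/

theorem measurable_shift : Measurable (shift M N) :=
  (measurable_leftShift.comp measurable_subtype_coe).subtype_mk

theorem val_semiconj :
    Function.Semiconj ((↑) : dyckMotzkinShift M N → ℤ → Letter M N) (shift M N) leftShift :=
  fun _ => rfl

/-- A measure on the Dyck-Motzkin shift as a measure on the full shift. -/
noncomputable def embed (m : ProbabilityMeasure (dyckMotzkinShift M N)) :
    ProbabilityMeasure (ℤ → Letter M N) :=
  m.map measurable_subtype_coe.aemeasurable

theorem continuous_embed : Continuous (embed (M := M) (N := N)) :=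
  ProbabilityMeasure.continuous_map continuous_subtype_val

@[simp] theorem rematchProb_embed (m : ProbabilityMeasure (dyckMotzkinShift M N)) :
    rematchProb (embed m) = m := by
  refine Subtype.ext ?_
  change ((m : Measure (dyckMotzkinShift M N)).map Subtype.val).map rematch = m
  rw [Measure.map_map measurable_rematch measurable_subtype_coe]
  convert Measure.map_id
  ext x : 1
  exact rematch_coe x

theorem measurable_sgn_val :
    Measurable fun x : dyckMotzkinShift M N => ((x.1 0).sgn : ℝ) :=
  (measurable_sgn_apply 0).comp measurable_subtype_coe

theorem drift_embed (m : ProbabilityMeasure (dyckMotzkinShift M N)) :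
    drift (embed m : Measure (ℤ → Letter M N)) =
      ∫ x : dyckMotzkinShift M N, ((x.1 0).sgn : ℝ) ∂(m : Measure (dyckMotzkinShift M N)) :=
  integral_map measurable_subtype_coe.aemeasurable (measurable_sgn_apply 0).aestronglyMeasurable

theorem drift_rematchProb (κ : ProbabilityMeasure (ℤ → Letter M N)) :
    drift (embed (rematchProb κ) : Measure (ℤ → Letter M N)) =
      drift (κ : Measure (ℤ → Letter M N)) := by
  rw [drift_embed]
  change ∫ x : dyckMotzkinShift M N, ((x.1 0).sgn : ℝ)
    ∂(κ : Measure (ℤ → Letter M N)).map rematch = _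
  rw [integral_map measurable_rematch.aemeasurable measurable_sgn_val.aestronglyMeasurable]
  refine integral_congr_ae (ae_of_all _ fun x => ?_)
  change ((rematchFun x 0).sgn : ℝ) = _
  simp [rematchFun]

theorem ergodic_embed (m : ergodicMeasures M N) :
    Ergodic leftShift (embed m.1 : Measure (ℤ → Letter M N)) :=
  (measurable_subtype_coe.measurePreserving _).ergodic_of_ergodic_semiconj m.2
    measurable_leftShift val_semiconj

theorem rematchProb_mem {κ : ProbabilityMeasure (ℤ → Letter M N)}
    (hκ : Ergodic leftShift (κ : Measure (ℤ → Letter M N))) :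
    rematchProb κ ∈ ergodicMeasures M N :=
  (measurable_rematch.measurePreserving _).ergodic_of_ergodic_semiconj hκ measurable_shift
    rematch_semiconj

/-- The drift of an ergodic measure on the Dyck-Motzkin shift. -/
noncomputable def ergodicDrift (m : ergodicMeasures M N) : ℝ :=
  drift (embed m.1 : Measure (ℤ → Letter M N))

theorem continuous_ergodicDrift : Continuous (ergodicDrift (M := M) (N := N)) := by
  have hc : Continuous fun x : ℤ → Letter M N => ((x 0).sgn : ℝ) :=
    (continuous_of_discreteTopology (f := fun s : Letter M N => (s.sgn : ℝ))).comp
      (continuous_apply 0)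
  have := ProbabilityMeasure.continuous_integral_boundedContinuousFunction
    (BoundedContinuousFunction.ofNormedAddCommGroup _ hc 1 fun x => abs_sgn_le_one _)
  exact this.comp (continuous_embed.comp continuous_subtype_val)

/-- The path of ergodic measures between two ergodic measures. -/
noncomputable def ergodicInterpolate (μ ν : ergodicMeasures M N) (ε s : I) : ergodicMeasures M N :=
  ⟨rematchProb (interpolate (embed μ.1) (embed ν.1) ε s),
    rematchProb_mem (ergodic_interpolate (ergodic_embed μ) (ergodic_embed ν) ε s)⟩

theorem continuous_ergodicInterpolate {μ ν : ergodicMeasures M N} (hμ : 0 ≤ ergodicDrift μ)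
    (hν : 0 ≤ ergodicDrift ν) {ε : I} (hε : 0 < ε) : Continuous (ergodicInterpolate μ ν ε) := by
  refine Continuous.subtype_mk (continuous_iff_continuousAt.2 fun s => ?_) _
  have h1 := (ergodic_embed μ).toMeasurePreserving
  have h2 := (ergodic_embed ν).toMeasurePreserving
  refine tendsto_rematchProb (continuous_interpolate h1 h2 hε).continuousAt
    (ae_rightMatched (ergodic_interpolate (ergodic_embed μ) (ergodic_embed ν) ε s) ?_)
  have h3 : 0 ≤ drift (interpolate (embed μ.1) (embed ν.1) ε s : Measure (ℤ → Letter M N)) := by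
    rw [drift_interpolate h1 h2 hε]
    exact add_nonneg (mul_nonneg s.2.1 hν) (mul_nonneg (by linarith [s.2.2]) hμ)
  exact h3

/-- Two ergodic measures of nonnegative drift are joined by a path. -/
noncomputable def ergodicPath {μ ν : ergodicMeasures M N} (hμ : 0 ≤ ergodicDrift μ)
    (hν : 0 ≤ ergodicDrift ν) {ε : I} (hε : 0 < ε) : Path μ ν where
  toFun := ergodicInterpolate μ ν ε
  continuous_toFun := continuous_ergodicInterpolate hμ hν hε
  source' := Subtype.ext (by simp [ergodicInterpolate])
  target' := Subtype.ext (by simp [ergodicInterpolate])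

/-- The factor `𝓟 univ` makes the convergence uniform in s, so that entire paths enter each
neighbourhood of μ. -/
theorem tendsto_ergodicInterpolate {μ : ergodicMeasures M N} (hμ : 0 ≤ ergodicDrift μ) :
    Tendsto (fun r : (ergodicMeasures M N × I) × I => ergodicInterpolate μ r.1.1 r.1.2 r.2)
      ((𝓝 μ ×ˢ 𝓝[>] 0) ×ˢ 𝓟 univ) (𝓝 μ) := by
  rw [IsInducing.subtypeVal.tendsto_nhds_iff]
  have key : Tendsto (fun r : (ergodicMeasures M N × I) × I =>
      interpolate (embed μ.1) (embed r.1.1.1) r.1.2 r.2)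
      ((𝓝 μ ×ˢ 𝓝[>] 0) ×ˢ 𝓟 univ) (𝓝 (embed μ.1)) := by
    refine tendsto_of_isWindowSet IsInducing.id fun n A hA => ?_
    simp only [preimage_id_eq, id]
    have hνA : Tendsto (fun r : (ergodicMeasures M N × I) × I =>
        |(embed r.1.1.1 : Measure (ℤ → Letter M N)).real A -
          (embed μ.1 : Measure (ℤ → Letter M N)).real A|)
        ((𝓝 μ ×ˢ 𝓝[>] 0) ×ˢ 𝓟 univ) (𝓝 0) := by
      have h1 : Tendsto (fun m : ergodicMeasures M N =>
          (embed m.1 : Measure (ℤ → Letter M N)) A) (𝓝 μ)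
          (𝓝 ((embed μ.1 : Measure (ℤ → Letter M N)) A)) :=
        ProbabilityMeasure.tendsto_measure_of_null_frontier_of_tendsto'
          (continuous_embed.comp continuous_subtype_val).continuousAt
          (by rw [hA.isClopen.frontier_eq, measure_empty])
      have h2 := (ENNReal.tendsto_toReal (measure_ne_top _ _)).comp h1
      have h3 := (h2.comp ((tendsto_fst.comp tendsto_fst :
        Tendsto (fun r : (ergodicMeasures M N × I) × I => r.1.1)
          ((𝓝 μ ×ˢ 𝓝[>] 0) ×ˢ 𝓟 univ) (𝓝 μ)))).sub_const
            ((embed μ.1 : Measure (ℤ → Letter M N)).real A)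
      have h4 := h3.abs
      rw [← measureReal_def, sub_self, abs_zero] at h4
      exact h4
    have hεA : Tendsto (fun r : (ergodicMeasures M N × I) × I => 2 * n * (r.1.2 : ℝ))
        ((𝓝 μ ×ˢ 𝓝[>] 0) ×ˢ 𝓟 univ) (𝓝 0) := by
      have h1 : Tendsto (fun ε : I => 2 * n * (ε : ℝ)) (𝓝[>] 0) (𝓝 0) := by
        have := Continuous.tendsto (f := fun ε : I => 2 * n * (ε : ℝ)) (by fun_prop) 0
        exact tendsto_nhdsWithin_of_tendsto_nhds (by simpa using this)
      exact h1.comp (tendsto_snd.comp tendsto_fst)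
    have hsum := hεA.add hνA
    rw [add_zero] at hsum
    rw [← tendsto_sub_nhds_zero_iff]
    refine squeeze_zero_norm' ?_ hsum
    have hpos : ∀ᶠ r : (ergodicMeasures M N × I) × I in (𝓝 μ ×ˢ 𝓝[>] 0) ×ˢ 𝓟 univ,
        0 < r.1.2 :=
      (tendsto_snd.comp tendsto_fst).eventually
        (self_mem_nhdsWithin : Ioi (0 : I) ∈ 𝓝[>] 0)
    filter_upwards [hpos] with r hr
    have h1 := abs_interpolate_sub_le (ergodic_embed μ).toMeasurePreserving
      (ergodic_embed r.1.1).toMeasurePreserving hr r.2 hA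
    have h2 := rate_le r.1.2 r.2
    have h3 : (2 : ℝ) * n * rate r.1.2 r.2 ≤ 2 * n * r.1.2 :=
      mul_le_mul_of_nonneg_left h2 (by positivity)
    set a := (embed r.1.1.1 : Measure (ℤ → Letter M N)).real A
    set b := (embed μ.1 : Measure (ℤ → Letter M N)).real A
    set x := (interpolate (embed μ.1) (embed r.1.1.1) r.1.2 r.2 : Measure _).real A
    calc ‖x - b‖ = |(x - (r.2 * a + (1 - r.2) * b)) + r.2 * (a - b)| := by
          rw [Real.norm_eq_abs]
          ring_nf
      _ ≤ |x - (r.2 * a + (1 - r.2) * b)| + |r.2 * (a - b)| := abs_add_le _ _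
      _ ≤ 2 * n * r.1.2 + |a - b| := by
          refine add_le_add (h1.trans h3) ?_
          rw [abs_mul, abs_of_nonneg r.2.2.1]
          exact mul_le_of_le_one_left (abs_nonneg _) r.2.2.2
  have := tendsto_rematchProb key (ae_rightMatched (ergodic_embed μ) hμ)
  rwa [rematchProb_embed] at this

theorem eventually_joinedIn_of_nonneg {μ : ergodicMeasures M N} (hμ : 0 ≤ ergodicDrift μ)
    {U : Set (ergodicMeasures M N)} (hU : U ∈ 𝓝 μ) :
    ∀ᶠ ν in 𝓝 μ, 0 ≤ ergodicDrift ν → JoinedIn U μ ν := by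
  have h1 := (tendsto_ergodicInterpolate hμ).eventually hU
  rw [eventually_prod_principal_iff] at h1
  -- The choice of ε is made after ν, and may depend on it.
  filter_upwards [h1.curry] with ν hν hν0
  have : (𝓝[>] (0 : I)).NeBot := nhdsGT_neBot_of_exists_gt ⟨1, one_pos⟩
  obtain ⟨ε, hε, hε0⟩ := (hν.and self_mem_nhdsWithin).exists
  exact ⟨ergodicPath hμ hν0 hε0, fun s => hε s (mem_univ s)⟩

/-! ### Time reversal of measures -/

theorem continuous_rev : Continuous (rev (M := M) (N := N)) := by
  refine Continuous.subtype_mk (continuous_pi fun i => ?_) _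
  exact (continuous_of_discreteTopology (f := Letter.swap)).comp
    ((continuous_apply (-i)).comp continuous_subtype_val)

theorem ergodic_map_rev {m : Measure (dyckMotzkinShift M N)} (hm : Ergodic (shift M N) m) :
    Ergodic (shift M N) (m.map rev) := by
  have hr : Measurable (rev (M := M) (N := N)) := continuous_rev.measurable
  refine ⟨⟨measurable_shift, ?_⟩, ⟨fun A hA hAs => ?_⟩⟩
  · conv_lhs => rw [← hm.map_eq]
    rw [Measure.map_map hr measurable_shift,
      Measure.map_map measurable_shift (hr.comp measurable_shift)]
    congr 1
    exact funext shift_rev_shift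
  · have h1 : shift M N ⁻¹' (rev ⁻¹' A) = rev ⁻¹' A := by
      conv_lhs => rw [← hAs]
      ext x
      simp only [mem_preimage, shift_rev_shift]
    have h2 := hm.aeconst_set (hr hA) h1
    rwa [(hr.measurePreserving m).aeconst_preimage hA.nullMeasurableSet] at h2

/-- Time reversal of ergodic measures. -/
noncomputable def revMeasure (m : ergodicMeasures M N) : ergodicMeasures M N :=
  ⟨m.1.map continuous_rev.measurable.aemeasurable, ergodic_map_rev m.2⟩

theorem continuous_revMeasure : Continuous (revMeasure (M := M) (N := N)) :=
  ((ProbabilityMeasure.continuous_map continuous_rev).comp continuous_subtype_val).subtype_mk _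

@[simp] theorem revMeasure_revMeasure (m : ergodicMeasures M N) :
    revMeasure (revMeasure m) = m := by
  refine Subtype.ext (Subtype.ext ?_)
  change ((m.1 : Measure (dyckMotzkinShift M N)).map rev).map rev = m.1
  rw [Measure.map_map continuous_rev.measurable continuous_rev.measurable]
  convert Measure.map_id
  ext x : 1
  exact rev_rev x

@[simp] theorem ergodicDrift_revMeasure (m : ergodicMeasures M N) :
    ergodicDrift (revMeasure m) = -ergodicDrift m := by
  rw [ergodicDrift, ergodicDrift, drift_embed, drift_embed]
  change ∫ x : dyckMotzkinShift M N, ((x.1 0).sgn : ℝ)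
    ∂(m.1 : Measure (dyckMotzkinShift M N)).map rev = _
  rw [integral_map continuous_rev.measurable.aemeasurable measurable_sgn_val.aestronglyMeasurable,
    ← integral_neg]
  refine integral_congr_ae (ae_of_all _ fun x => ?_)
  change (((x.1 (-0)).swap.sgn : ℤ) : ℝ) = _
  simp

theorem eventually_joinedIn_of_nonpos {μ : ergodicMeasures M N} (hμ : ergodicDrift μ ≤ 0)
    {U : Set (ergodicMeasures M N)} (hU : U ∈ 𝓝 μ) :
    ∀ᶠ ν in 𝓝 μ, ergodicDrift ν ≤ 0 → JoinedIn U μ ν := by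
  have h1 := eventually_joinedIn_of_nonneg (μ := revMeasure μ) (U := revMeasure ⁻¹' U)
    (by simpa using hμ) (continuous_revMeasure.continuousAt.preimage_mem_nhds (by simpa using hU))
  filter_upwards [continuous_revMeasure.continuousAt.eventually h1] with ν hν hν0
  have h2 := (hν (by simpa using hν0)).map continuous_revMeasure
  simp only [revMeasure_revMeasure] at h2
  exact h2.mono (image_preimage_subset _ _)

/-! ### Joining measures within each drift sign, and a measure of zero drift. -/

theorem joined_of_nonneg {μ ν : ergodicMeasures M N} (hμ : 0 ≤ ergodicDrift μ)
    (hν : 0 ≤ ergodicDrift ν) : Joined μ ν :=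
  ⟨ergodicPath hμ hν one_pos⟩

theorem joined_of_nonpos {μ ν : ergodicMeasures M N} (hμ : ergodicDrift μ ≤ 0)
    (hν : ergodicDrift ν ≤ 0) : Joined μ ν := by
  have h := (joined_of_nonneg (μ := revMeasure μ) (ν := revMeasure ν) (by simpa using hμ)
    (by simpa using hν)).map continuous_revMeasure
  simpa using h

/-- Toss a fair coin between the two brackets of one pair, then rematch; rematching preserves the
drift. -/
theorem exists_ergodicDrift_eq_zero (hM : 0 < M) :
    ∃ m : ergodicMeasures M N, ergodicDrift m = 0 := by
  let a : Fin M := ⟨0, hM⟩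
  let P : Measure (Letter M N) := (2⁻¹ : ENNReal) • Measure.dirac (Letter.left a) +
    (2⁻¹ : ENNReal) • Measure.dirac (Letter.right a)
  have : IsProbabilityMeasure P := ⟨by simp [P, ENNReal.inv_two_add_inv_two]⟩
  refine ⟨⟨rematchProb ⟨bernoulli P, inferInstance⟩,
    rematchProb_mem (ergodic_leftShift_bernoulli P)⟩, ?_⟩
  refine (drift_rematchProb _).trans ?_
  change ∫ x, ((x 0).sgn : ℝ) ∂bernoulli P = 0
  have h1 : (bernoulli P).map (fun x => x 0) = P := Measure.infinitePi_map_eval _ 0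
  have h2 : Measurable fun s : Letter M N => (s.sgn : ℝ) := measurable_of_countable _
  have h3 := integral_map (μ := bernoulli P) (measurable_pi_apply (0 : ℤ)).aemeasurable
    (f := fun s : Letter M N => (s.sgn : ℝ)) h2.aestronglyMeasurable
  rw [h1] at h3
  rw [← h3, integral_add_measure, integral_smul_measure, integral_smul_measure,
    integral_dirac, integral_dirac]
  · simp [Letter.sgn]
  · exact (integrable_dirac (by simp)).smul_measure (by simp)
  · exact (integrable_dirac (by simp)).smul_measure (by simp)

end DyckMotzkin

theorem theoremB (M N : ℕ) (hM : 2 ≤ M) :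
    PathConnectedSpace (DyckMotzkin.ergodicMeasures M N) ∧
      LocallyPathConnectedSpace (DyckMotzkin.ergodicMeasures M N) := by
  open DyckMotzkin Filter Topology in
  constructor
  · obtain ⟨m, hm⟩ := exists_ergodicDrift_eq_zero (M := M) (N := N) (by omega)
    have key : ∀ μ : ergodicMeasures M N, Joined m μ := fun μ =>
      (le_total 0 (ergodicDrift μ)).elim (joined_of_nonneg hm.ge) (joined_of_nonpos hm.le)
    exact ⟨⟨m⟩, fun μ ν => (key μ).symm.trans (key ν)⟩
  · refine locallyPathConnectedSpace_iff_pathComponentIn_mem_nhds.2 fun μ U hU hμU => ?_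
    have hUμ := hU.mem_nhds hμU
    have hc := continuous_ergodicDrift.continuousAt (x := μ)
    change ∀ᶠ ν in 𝓝 μ, JoinedIn U μ ν
    -- If the drift of μ is non-zero, nearby measures share its sign; if it is zero, each nearby ν
    -- uses the construction for its own sign.
    rcases lt_trichotomy (ergodicDrift μ) 0 with h | h | h
    · filter_upwards [eventually_joinedIn_of_nonpos h.le hUμ, hc.eventually_lt_const h]
        with ν h1 h2 using h1 h2.le
    · filter_upwards [eventually_joinedIn_of_nonpos h.le hUμ,
        eventually_joinedIn_of_nonneg h.ge hUμ] with ν h1 h2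
      exact (le_total 0 (ergodicDrift ν)).elim h2 h1
    · filter_upwards [eventually_joinedIn_of_nonneg h.le hUμ, hc.eventually_const_lt h]
        with ν h1 h2 using h1 h2.le
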